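/- An $r$-gentiling of a plane figure $T$ is a subdivision of $T$ into $r\ge 2$ figures (tiles) with pairwise disjoint interiors, each of which is similar to $T$; an $r$-reptiling is an $r$-gentiling whose tiles are mutually congruent. For $k \ge 2$, a gentiling of a triangle $T$ is called $k$-splitting if $k$ of its tiles meet in one of the vertices of $T$. A triangle is oblique if it is not a right triangle. Theorem. No oblique isosceles triangle $T$ admits a $k$-splitting reptiling for any $k \ge 2$; that is, if $T$ is an isosceles triangle without a right angle, then for every $k\ge 2$ and every $r \ge 2$ there is no $r$-reptiling of $T$ in which $k$ tiles meet in one of the vertices of $T$. -/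

import Mathlib

/-- The Euclidean plane. -/
abbrev Plane : Type := EuclideanSpace ℝ (Fin 2)

/-- Two figures (sets of points of the plane) are similar if some similarity transformation of the
plane (reflections allowed) maps one onto the other. -/
def SimilarFigures (F G : Set Plane) : Prop :=
  ∃ f : Plane ≃ᵈ Plane, f '' F = G

/-- Two figures are congruent if some isometry of the plane (reflections allowed) maps one onto
the other. -/
def CongruentFigures (F G : Set Plane) : Prop :=
  ∃ g : Plane ≃ᵢ Plane, g '' F = G

/-- An `r`-gentiling of a figure `F`: a subdivision of `F` into `r ≥ 2` tiles (they cover exactly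
`F`, and no two of them have a common interior point), each of them similar to `F`. -/
def IsGentiling (F : Set Plane) (r : ℕ) (tile : Fin r → Set Plane) : Prop :=
  2 ≤ r ∧ (∀ i, SimilarFigures F (tile i)) ∧ (⋃ i, tile i) = F ∧
    ∀ i j, i ≠ j → Disjoint (interior (tile i)) (interior (tile j))

/-- An `r`-reptiling of a figure: an `r`-gentiling whose tiles are mutually congruent. -/
def IsReptiling (F : Set Plane) (r : ℕ) (tile : Fin r → Set Plane) : Prop :=
  IsGentiling F r tile ∧ ∀ i j, CongruentFigures (tile i) (tile j)

/-- The tiling of the triangle `T` by the given tiles is `k`-splitting (a notion used for `k ≥ 2`):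
exactly `k` of the tiles meet in one of the vertices of `T`. -/
def IsSplitting (T : Affine.Triangle ℝ Plane) (k : ℕ) {r : ℕ} (tile : Fin r → Set Plane) : Prop :=
  2 ≤ k ∧ ∃ v : Fin 3, {i : Fin r | T.points v ∈ tile i}.ncard = k

/-- A triangle is isosceles if (at least) two of its sides have equal length. -/
def IsIsosceles (T : Affine.Triangle ℝ Plane) : Prop :=
  ∃ i j k : Fin 3, i ≠ j ∧ j ≠ k ∧ i ≠ k ∧
    dist (T.points i) (T.points j) = dist (T.points i) (T.points k)

/-- A triangle is oblique if none of its angles is a right angle. -/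
def IsOblique (T : Affine.Triangle ℝ Plane) : Prop :=
  ∀ i j k : Fin 3, i ≠ j → j ≠ k → i ≠ k →
    EuclideanGeometry.angle (T.points i) (T.points j) (T.points k) ≠ Real.pi / 2

open Filter Topology

/-! Let the tiles have legs `a`, base `b`, base angle α and apex angle γ = π − 2α. Comparing areas,
T is a tile enlarged by a factor s with s² = r (`card_mul_sq_ratio_eq_one`). A corner of T is an
extreme point, so every tile containing it has a vertex there, and the tile angles add up to the
angle of T (`IsoscelesTiling.sum_vertexAngle`). Hence a split base corner forces α = kγ and a split
apex forces γ = kα (`forall_of_sum_ite_eq`); in the second case k ≥ 3, since k = 2 gives a right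
angle. Either way α is a rational multiple of π other than π/3, so by Niven's theorem b/a = 2 cos α
is irrational (`irrational_div_of_baseAngle`).

Edges of T consist of tile legs and tile bases, so sa = xa + yb and sb = za + wb with natural
coefficients. As s² is an integer and b/a is irrational, either y = z = 0 or x = w = 0
(`eq_zero_of_scaled_combination`): each edge of T carries only one kind of tile edge, and legs and
bases of T carry different kinds.

At a split base corner Q all tiles have their apex at Q, so both edges from Q carry a tile leg, a
contradiction (`IsoscelesTiling.not_split_base`). If the apex is split, then γ is obtuse and some
edge from Q carries legs only. Two apices cannot meet at a point of that edge and none lies at Q, so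
every leg points its apex away from Q and the last one puts an apex at the far end
(`IsoscelesTiling.exists_apex_eq`), where only base angles are possible
(`IsoscelesTiling.not_split_apex`). -/

/-! ### Triangles as convex hulls, finite closed covers, disjoint interiors -/

theorem mem_convexHull_triple {E : Type*} [AddCommGroup E] [Module ℝ E] {x y w z : E} :
    z ∈ convexHull ℝ {x, y, w} ↔
      ∃ p q r : ℝ, 0 ≤ p ∧ 0 ≤ q ∧ 0 ≤ r ∧ p + q + r = 1 ∧ p • x + q • y + r • w = z := by
  constructor
  · rw [convexHull_insert (by simp), convexHull_pair, mem_convexJoin]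
    rintro ⟨_, rfl, u, ⟨c, d, hc, hd, hcd, rfl⟩, e, f, he, hf, hef, rfl⟩
    refine ⟨e, f * c, f * d, he, by positivity, by positivity, ?_, ?_⟩
    · rw [add_assoc, ← mul_add, hcd, mul_one, hef]
    · rw [smul_add, smul_smul, smul_smul, add_assoc]
  · rintro ⟨p, q, r, hp, hq, hr, h, rfl⟩
    have hs := convex_convexHull ℝ ({x, y, w} : Set E)
    have key := hs.sum_mem (t := Finset.univ) (w := ![p, q, r]) (z := ![x, y, w])
      (by intro i _; fin_cases i <;> simpa) (by simp [Fin.sum_univ_three, h])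
      (by intro i _; fin_cases i <;> apply subset_convexHull <;> simp)
    simpa [Fin.sum_univ_three] using key

theorem isClosed_convexHull_triple (x y w : ℂ) : IsClosed (convexHull ℝ {x, y, w}) :=
  (Set.toFinite _).isClosed_convexHull ℝ

theorem convexHull_triple_left_comm (x y w : ℂ) :
    convexHull ℝ {x, y, w} = convexHull ℝ {y, x, w} := by
  rw [Set.insert_comm]

theorem convexHull_triple_right_comm (x y w : ℂ) :
    convexHull ℝ {x, y, w} = convexHull ℝ {x, w, y} := by
  rw [Set.pair_comm]

/-- If finitely many closed sets cover a path near a time, then one of them contains the path at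
that time and also at nearby times. -/
theorem exists_frequently_mem_of_cover {ι X : Type*} [Finite ι] [TopologicalSpace X]
    {F : ι → Set X} (hF : ∀ i, IsClosed (F i)) {c : ℝ → X} (hc : Continuous c) {p : ℝ}
    {l : Filter ℝ} [l.NeBot] (hl : l ≤ 𝓝 p) (h : ∀ᶠ t in l, c t ∈ ⋃ i, F i) :
    ∃ i, c p ∈ F i ∧ ∃ᶠ t in l, c t ∈ F i := by
  have h1 : ∃ i, ∃ᶠ t in l, c t ∈ F i := by
    by_contra! hcon
    have h2 : ∀ᶠ t in l, ∀ i, c t ∉ F i := by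
      rw [eventually_all]
      intro i
      exact hcon i
    obtain ⟨t, ht, ht'⟩ := (h.and h2).exists
    obtain ⟨i, hi⟩ := Set.mem_iUnion.mp ht
    exact ht' i hi
  obtain ⟨i, hi⟩ := h1
  exact ⟨i, (hF i).mem_of_frequently_of_tendsto hi ((hc.tendsto p).mono_left hl), hi⟩

/-- The line from `w` through m + ηi meets the real axis at a point that tends to m as η → 0, hence
eventually lies between x and y. This supplies a common point of two tiles off the axis. -/
theorem eventually_add_mul_I_mem {S : Set ℂ} (hS : Convex ℝ S) {x y m : ℝ} {w : ℂ}
    (hx : (x : ℂ) ∈ S) (hy : (y : ℂ) ∈ S) (hw : w ∈ S) (hw0 : 0 < w.im)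
    (hm : m ∈ Set.Ioo x y) : ∀ᶠ η : ℝ in 𝓝[>] 0, (m : ℂ) + η * Complex.I ∈ S := by
  have hcont : ContinuousAt (fun η : ℝ ↦ (m - η / w.im * w.re) / (1 - η / w.im)) 0 := by
    refine ContinuousAt.div (by fun_prop) (by fun_prop) (by simp)
  have h1 : ∀ᶠ η : ℝ in 𝓝 0, (m - η / w.im * w.re) / (1 - η / w.im) ∈ Set.Ioo x y :=
    hcont.eventually_mem (Ioo_mem_nhds (by simpa using hm.1) (by simpa using hm.2))
  have h2 : ∀ᶠ η : ℝ in 𝓝 0, η < w.im := eventually_lt_nhds hw0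
  filter_upwards [nhdsWithin_le_nhds h1, nhdsWithin_le_nhds h2, self_mem_nhdsWithin]
    with η hη hηw hη0
  have hη0' : 0 < η := hη0
  have hlt : η / w.im < 1 := (div_lt_one hw0).mpr hηw
  have hpos : 0 < η / w.im := div_pos hη0' hw0
  set c := (m - η / w.im * w.re) / (1 - η / w.im) with hc
  have hcS : (c : ℂ) ∈ S := by
    have hxy : 0 < y - x := by linarith [hm.1, hm.2]
    have := hS hx hy (a := (y - c) / (y - x)) (b := (c - x) / (y - x))
      (div_nonneg (by linarith [hη.2]) hxy.le) (div_nonneg (by linarith [hη.1]) hxy.le)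
      (by field_simp; ring)
    convert this using 1
    rw [Complex.real_smul, Complex.real_smul, ← Complex.ofReal_mul, ← Complex.ofReal_mul,
      ← Complex.ofReal_add, Complex.ofReal_inj]
    field_simp
    ring
  have := hS hcS hw (a := 1 - η / w.im) (b := η / w.im) (by linarith) hpos.le (by ring)
  convert this using 1
  have hc' : (1 - η / w.im) * c = m - η / w.im * w.re := by
    rw [hc, mul_div_cancel₀ _ (by linarith)]
  apply Complex.ext
  · simp [hc']
  · simp; field_simp

/-- Convex sets with disjoint interiors have no three common non-collinear points. -/
theorem cross_eq_zero_of_disjoint_interior {S S' : Set ℂ} (hS : Convex ℝ S) (hS' : Convex ℝ S')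
    (hd : Disjoint (interior S) (interior S')) {x y z : ℂ} (hx : x ∈ S ∩ S') (hy : y ∈ S ∩ S')
    (hz : z ∈ S ∩ S') :
    (y - x).re * (z - x).im - (y - x).im * (z - x).re = 0 := by
  by_contra hne
  set D := (y - x).re * (z - x).im - (y - x).im * (z - x).re with hD
  have hcv := hS.inter hS'
  have htop : affineSpan ℝ (S ∩ S') = ⊤ := by
    rw [eq_top_iff]
    intro p _
    have hx' := subset_affineSpan ℝ _ hx
    have hy' := subset_affineSpan ℝ _ hy
    have hz' := subset_affineSpan ℝ _ hz
    -- Cramer's rule: the two coefficients are the coordinates of p − x in the basis y − x, z − x.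
    have h1 := AffineSubspace.smul_vsub_vadd_mem _
      (((p - x).re * (z - x).im - (p - x).im * (z - x).re) / D) hy' hx' hx'
    have h2 := AffineSubspace.smul_vsub_vadd_mem _
      (((y - x).re * (p - x).im - (y - x).im * (p - x).re) / D) hz' hx' h1
    convert h2 using 1
    apply Complex.ext
    · simp
      field_simp
      simp [hD]
      ring
    · simp
      field_simp
      simp [hD]
      ring
  have := hcv.interior_nonempty_iff_affineSpan_eq_top.mpr htop
  rw [interior_inter, hd.inter_eq] at this
  exact Set.not_nonempty_empty this

/-! ### Angles as lengths of intervals of directions -/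

/-- The directions in `[0, π]` in which the set `S` can be met from the origin. -/
def directions (S : Set ℂ) : Set ℝ :=
  {τ | τ ∈ Set.Icc 0 Real.pi ∧ ∃ ε : ℝ, 0 < ε ∧ (ε : ℂ) * Complex.exp (τ * Complex.I) ∈ S}

theorem mul_exp_re (ε τ : ℝ) :
    ((ε : ℂ) * Complex.exp (τ * Complex.I)).re = ε * Real.cos τ := by
  simp [Complex.exp_ofReal_mul_I_re]

theorem mul_exp_im (ε τ : ℝ) :
    ((ε : ℂ) * Complex.exp (τ * Complex.I)).im = ε * Real.sin τ := by
  simp [Complex.exp_ofReal_mul_I_im]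

theorem exists_eq_mul_exp {z : ℂ} (hz : z ≠ 0) (him : 0 ≤ z.im) :
    ∃ ε τ : ℝ, 0 < ε ∧ τ ∈ Set.Icc 0 Real.pi ∧ z = ε * Complex.exp (τ * Complex.I) :=
  ⟨‖z‖, z.arg, norm_pos_iff.mpr hz, ⟨Complex.arg_nonneg_iff.mpr him, Complex.arg_le_pi z⟩,
    (Complex.norm_mul_exp_arg_mul_I z).symm⟩

theorem angle_mul_exp {ε δ s t : ℝ} (hε : 0 < ε) (hδ : 0 < δ) (hst : s ≤ t)
    (hst' : t - s ≤ Real.pi) :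
    InnerProductGeometry.angle ((ε : ℂ) * Complex.exp (s * Complex.I))
      ((δ : ℂ) * Complex.exp (t * Complex.I)) = t - s := by
  have h : (inner ℝ ((ε : ℂ) * Complex.exp (s * Complex.I))
      ((δ : ℂ) * Complex.exp (t * Complex.I)) : ℝ) = ε * δ * Real.cos (t - s) := by
    rw [Complex.inner, Complex.mul_re, Complex.conj_re, Complex.conj_im, mul_exp_re, mul_exp_re,
      mul_exp_im, mul_exp_im, Real.cos_sub]
    ring
  rw [InnerProductGeometry.angle, h]
  simp only [norm_mul, Complex.norm_exp_ofReal_mul_I, Complex.norm_real, Real.norm_eq_abs,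
    abs_of_pos hε, abs_of_pos hδ, mul_one]
  rw [mul_div_cancel_left₀ _ (by positivity), Real.arccos_cos (by linarith) hst']

theorem directions_triangle_of_lt {ε δ s t : ℝ} (hε : 0 < ε) (hδ : 0 < δ) (hs : 0 ≤ s)
    (hst : s < t) (ht : t ≤ Real.pi) (hst' : t - s < Real.pi) :
    directions (convexHull ℝ {0, (ε : ℂ) * Complex.exp (s * Complex.I),
      (δ : ℂ) * Complex.exp (t * Complex.I)}) = Set.Icc s t := by
  have hsin : 0 < Real.sin (t - s) := Real.sin_pos_of_pos_of_lt_pi (by linarith) hst'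
  ext τ
  constructor
  · rintro ⟨⟨h0, hπ⟩, η, hη, hmem⟩
    obtain ⟨p, q, r, hp, hq, hr, -, h⟩ := mem_convexHull_triple.mp hmem
    have hre := congrArg Complex.re h
    have him := congrArg Complex.im h
    simp only [smul_zero, zero_add, Complex.add_re, Complex.add_im, Complex.real_smul,
      ← mul_assoc, ← Complex.ofReal_mul, mul_exp_re, mul_exp_im] at hre him
    -- The cross product with each edge direction isolates the weight of the other edge, whose sign
    -- bounds τ.
    have h1 : η * Real.sin (τ - s) = r * δ * Real.sin (t - s) := by
      rw [Real.sin_sub, Real.sin_sub]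
      linear_combination -Real.cos s * him + Real.sin s * hre
    have h2 : η * Real.sin (t - τ) = q * ε * Real.sin (t - s) := by
      rw [Real.sin_sub, Real.sin_sub]
      linear_combination -Real.sin t * hre + Real.cos t * him
    constructor
    · by_contra! hlt
      have := Real.sin_neg_of_neg_of_neg_pi_lt (x := τ - s) (by linarith) (by linarith)
      nlinarith [mul_nonneg (mul_nonneg hr hδ.le) hsin.le]
    · by_contra! hlt
      have := Real.sin_neg_of_neg_of_neg_pi_lt (x := t - τ) (by linarith) (by linarith)
      nlinarith [mul_nonneg (mul_nonneg hq hε.le) hsin.le]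
  · rintro ⟨h1, h2⟩
    refine ⟨⟨by linarith, by linarith⟩, ?_⟩
    -- Coordinates of the unit vector in direction τ with respect to the two edges. Dividing by 1 +
    -- q + r leaves the remaining weight for the vertex 0.
    set q := Real.sin (t - τ) / (ε * Real.sin (t - s)) with hq
    set r := Real.sin (τ - s) / (δ * Real.sin (t - s)) with hr
    have hq0 : 0 ≤ q := div_nonneg
      (Real.sin_nonneg_of_nonneg_of_le_pi (by linarith) (by linarith)) (by positivity)
    have hr0 : 0 ≤ r := div_nonneg
      (Real.sin_nonneg_of_nonneg_of_le_pi (by linarith) (by linarith)) (by positivity)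
    refine ⟨1 / (1 + q + r), by positivity, mem_convexHull_triple.mpr
      ⟨1 / (1 + q + r), q / (1 + q + r), r / (1 + q + r), by positivity, by positivity,
        by positivity, by field_simp, ?_⟩⟩
    have e1 : q * ε * Real.cos s + r * δ * Real.cos t = Real.cos τ := by
      rw [hq, hr]
      field_simp
      simp only [Real.sin_sub]
      ring
    have e2 : q * ε * Real.sin s + r * δ * Real.sin t = Real.sin τ := by
      rw [hq, hr]
      field_simp
      simp only [Real.sin_sub]
      ring
    apply Complex.ext
    · simp only [smul_zero, zero_add, Complex.add_re, Complex.real_smul,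
        ← mul_assoc, ← Complex.ofReal_mul, mul_exp_re, ← e1]
      ring
    · simp only [smul_zero, zero_add, Complex.add_im, Complex.real_smul,
        ← mul_assoc, ← Complex.ofReal_mul, mul_exp_im, ← e2]
      ring

/-- The directions of a triangle of the upper half-plane with a vertex at the origin form an
interval whose length is the angle at that vertex. -/
theorem exists_directions_triangle {z w : ℂ} (hz : z ≠ 0) (hw : w ≠ 0) (hz0 : 0 ≤ z.im)
    (hw0 : 0 ≤ w.im) (h0 : 0 < InnerProductGeometry.angle z w)
    (hπ : InnerProductGeometry.angle z w < Real.pi) :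
    ∃ s t : ℝ, directions (convexHull ℝ {0, z, w}) = Set.Icc s t ∧
      t - s = InnerProductGeometry.angle z w := by
  obtain ⟨ε, s, hε, hs, rfl⟩ := exists_eq_mul_exp hz hz0
  obtain ⟨δ, t, hδ, ht, rfl⟩ := exists_eq_mul_exp hw hw0
  rcases le_total s t with hst | hst
  · rw [angle_mul_exp hε hδ hst (by linarith [hs.1, ht.2])] at h0 hπ ⊢
    exact ⟨s, t, directions_triangle_of_lt hε hδ hs.1 (by linarith) ht.2 hπ, rfl⟩
  · rw [InnerProductGeometry.angle_comm,
      angle_mul_exp hδ hε hst (by linarith [ht.1, hs.2])] at h0 hπ ⊢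
    rw [convexHull_triple_right_comm]
    exact ⟨t, s, directions_triangle_of_lt hδ hε ht.1 (by linarith) hs.2 hπ, rfl⟩

/-- Two common directions give, after shrinking towards 0, two common points that are not collinear
with 0; the bound by π excludes opposite directions. This contradicts
`cross_eq_zero_of_disjoint_interior`. -/
theorem directions_inter_subsingleton {S S' : Set ℂ} (hS : Convex ℝ S) (hS' : Convex ℝ S')
    (hd : Disjoint (interior S) (interior S')) (h0 : (0 : ℂ) ∈ S ∩ S') {s t : ℝ}
    (hst : directions S = Set.Icc s t) (hlt : t - s < Real.pi) :
    (directions S ∩ directions S').Subsingleton := by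
  suffices H : ∀ τ τ', τ < τ' → τ ∈ directions S ∩ directions S' →
      τ' ∈ directions S ∩ directions S' → False by
    intro τ hτ τ' hτ'
    rcases lt_trichotomy τ τ' with h | h | h
    · exact (H _ _ h hτ hτ').elim
    · exact h
    · exact (H _ _ h hτ' hτ).elim
  intro τ τ' hlt' hτ hτ'
  have common : ∀ σ ∈ directions S ∩ directions S', ∃ ε : ℝ, 0 < ε ∧
      (ε : ℂ) * Complex.exp (σ * Complex.I) ∈ S ∩ S' := by
    rintro σ ⟨⟨-, ε, hε, h⟩, -, δ, hδ, h'⟩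
    have shrink : ∀ {U : Set ℂ} {η : ℝ}, Convex ℝ U → (0 : ℂ) ∈ U → 0 < η → min ε δ ≤ η →
        (η : ℂ) * Complex.exp (σ * Complex.I) ∈ U →
        ((min ε δ : ℝ) : ℂ) * Complex.exp (σ * Complex.I) ∈ U := by
      intro U η hU hU0 hη hle hmem
      have := hU.smul_mem_of_zero_mem hU0 hmem (t := min ε δ / η)
        ⟨by positivity, (div_le_one hη).mpr hle⟩
      convert this using 1
      rw [Complex.real_smul, ← mul_assoc, ← Complex.ofReal_mul, div_mul_cancel₀ _ hη.ne']
    exact ⟨min ε δ, lt_min hε hδ, shrink hS h0.1 hε (min_le_left _ _) h,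
      shrink hS' h0.2 hδ (min_le_right _ _) h'⟩
  obtain ⟨ε, hε, h⟩ := common τ hτ
  obtain ⟨δ, hδ, h'⟩ := common τ' hτ'
  have key := cross_eq_zero_of_disjoint_interior hS hS' hd h0 h h'
  simp only [sub_zero, mul_exp_re, mul_exp_im] at key
  have h1 : τ' - τ < Real.pi := by
    have a1 := hst ▸ hτ.1
    have a2 := hst ▸ hτ'.1
    linarith [a1.1, a2.2]
  have hsin : 0 < Real.sin (τ' - τ) := Real.sin_pos_of_pos_of_lt_pi (by linarith) h1
  have : ε * δ * Real.sin (τ' - τ) = 0 := by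
    rw [Real.sin_sub]
    linear_combination key
  have : 0 < ε * δ * Real.sin (τ' - τ) := by positivity
  linarith

/-- Pairwise intersections of at most one point are null, which suffices for additivity. -/
theorem volume_biUnion_eq_sum {ι : Type*} (s : Finset ι) {J : ι → Set ℝ}
    (hJ : ∀ i ∈ s, MeasurableSet (J i))
    (hd : ∀ i ∈ s, ∀ j ∈ s, i ≠ j → (J i ∩ J j).Subsingleton) :
    MeasureTheory.volume (⋃ i ∈ s, J i) = ∑ i ∈ s, MeasureTheory.volume (J i) := by
  refine MeasureTheory.measure_biUnion_finset₀ ?_ fun i hi ↦ (hJ i hi).nullMeasurableSet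
  intro i hi j hj hij
  exact (hd i hi j hj hij).measure_zero _

theorem volume_biUnion_Icc {ι : Type*} (s : Finset ι) {J : ι → Set ℝ} {θ : ι → ℝ}
    (hθ : ∀ i ∈ s, 0 ≤ θ i) (hJ : ∀ i ∈ s, ∃ a b, J i = Set.Icc a b ∧ b - a = θ i)
    (hd : ∀ i ∈ s, ∀ j ∈ s, i ≠ j → (J i ∩ J j).Subsingleton) :
    MeasureTheory.volume (⋃ i ∈ s, J i) = ENNReal.ofReal (∑ i ∈ s, θ i) := by
  rw [volume_biUnion_eq_sum s _ hd, ENNReal.ofReal_sum_of_nonneg hθ]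
  · refine Finset.sum_congr rfl fun i hi ↦ ?_
    obtain ⟨a, b, h, h'⟩ := hJ i hi
    rw [h, Real.volume_Icc, h']
  · intro i hi
    obtain ⟨a, b, h, h'⟩ := hJ i hi
    rw [h]
    exact measurableSet_Icc

/-! ### Angles of an isosceles triangle -/

/-- The base angle of an isosceles triangle with legs `a` and base `b`. -/
noncomputable def baseAngle (a b : ℝ) : ℝ := Real.arccos (b / (2 * a))

/-- The apex angle of an isosceles triangle with legs `a` and base `b`. -/
noncomputable def apexAngle (a b : ℝ) : ℝ := Real.pi - 2 * baseAngle a b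

theorem cos_baseAngle {a b : ℝ} (ha : 0 < a) (hb : 0 < b) (hab : b < 2 * a) :
    Real.cos (baseAngle a b) = b / (2 * a) :=
  Real.cos_arccos (by have : 0 < b / (2 * a) := by positivity
                      linarith) ((div_le_one (by positivity)).mpr hab.le)

theorem baseAngle_pos {a b : ℝ} (ha : 0 < a) (hab : b < 2 * a) : 0 < baseAngle a b :=
  Real.arccos_pos.mpr ((div_lt_one (by positivity)).mpr hab)

theorem baseAngle_lt {a b : ℝ} (ha : 0 < a) (hb : 0 < b) : baseAngle a b < Real.pi / 2 :=
  Real.arccos_lt_pi_div_two.mpr (by positivity)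

theorem apexAngle_pos {a b : ℝ} (ha : 0 < a) (hb : 0 < b) : 0 < apexAngle a b := by
  have := baseAngle_lt ha hb
  rw [apexAngle]
  linarith

theorem apexAngle_lt {a b : ℝ} (ha : 0 < a) (hab : b < 2 * a) : apexAngle a b < Real.pi := by
  have := baseAngle_pos ha hab
  rw [apexAngle]
  linarith

theorem angle_eq_apexAngle {V : Type*} [NormedAddCommGroup V] [InnerProductSpace ℝ V] {a b : ℝ}
    (ha : 0 < a) (hb : 0 < b) (hab : b < 2 * a) {P Q R : V} (hPQ : dist P Q = a)
    (hPR : dist P R = a) (hQR : dist Q R = b) :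
    InnerProductGeometry.angle (Q - P) (R - P) = apexAngle a b := by
  have h1 := baseAngle_pos ha hab
  have h2 := apexAngle_pos ha hb
  have hcos : Real.cos (apexAngle a b) = 1 - b ^ 2 / (2 * a ^ 2) := by
    rw [apexAngle, Real.cos_pi_sub, Real.cos_two_mul, cos_baseAngle ha hb hab]
    field_simp
    ring
  rw [InnerProductGeometry.angle,
    real_inner_eq_norm_mul_self_add_norm_mul_self_sub_norm_sub_mul_self_div_two,
    sub_sub_sub_cancel_right, ← dist_eq_norm, ← dist_eq_norm, ← dist_eq_norm, dist_comm Q P,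
    dist_comm R P, hPQ, hPR, hQR, ← Real.arccos_cos (x := apexAngle a b) h2.le
      (by rw [apexAngle]; linarith), hcos]
  congr 1
  field_simp
  ring

theorem angle_eq_baseAngle {V : Type*} [NormedAddCommGroup V] [InnerProductSpace ℝ V] {a b : ℝ}
    (ha : 0 < a) (hb : 0 < b) {P Q R : V} (hPQ : dist P Q = a) (hPR : dist P R = a)
    (hQR : dist Q R = b) : InnerProductGeometry.angle (P - Q) (R - Q) = baseAngle a b := by
  rw [InnerProductGeometry.angle, baseAngle,
    real_inner_eq_norm_mul_self_add_norm_mul_self_sub_norm_sub_mul_self_div_two,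
    sub_sub_sub_cancel_right, ← dist_eq_norm, ← dist_eq_norm, ← dist_eq_norm, dist_comm R Q,
    hPQ, hPR, hQR]
  congr 1
  field_simp
  ring

/-! ### Isosceles tilings and their transport by isometries -/

/-- A tiling of the set `S` by isosceles triangles `A i`, `B i`, `C i` with apex `A i`, legs `a` and
base `b`. -/
structure IsoscelesTiling {ι : Type*} (a b : ℝ) (S : Set ℂ) (A B C : ι → ℂ) : Prop where
  leg_pos : 0 < a
  base_pos : 0 < b
  base_lt : b < 2 * a
  dist_AB : ∀ i, dist (A i) (B i) = a
  dist_AC : ∀ i, dist (A i) (C i) = a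
  dist_BC : ∀ i, dist (B i) (C i) = b
  iUnion_eq : ⋃ i, convexHull ℝ {A i, B i, C i} = S
  disjoint : ∀ i j, i ≠ j → Disjoint (interior (convexHull ℝ {A i, B i, C i}))
    (interior (convexHull ℝ {A j, B j, C j}))

theorem image_convexHull_triple (g : ℂ ≃ᵃⁱ[ℝ] ℂ) (x y z : ℂ) :
    g '' convexHull ℝ {x, y, z} = convexHull ℝ {g x, g y, g z} := by
  have := g.toAffineEquiv.toAffineMap.image_convexHull {x, y, z}
  simpa [Set.image_insert_eq] using this

theorem mem_convexHull_map_iff (g : ℂ ≃ᵃⁱ[ℝ] ℂ) {x y z p : ℂ} :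
    g p ∈ convexHull ℝ {g x, g y, g z} ↔ p ∈ convexHull ℝ {x, y, z} := by
  rw [← image_convexHull_triple, g.injective.mem_set_image]

theorem mem_segment_map_iff (g : ℂ ≃ᵃⁱ[ℝ] ℂ) {x y p : ℂ} :
    g p ∈ segment ℝ (g x) (g y) ↔ p ∈ segment ℝ x y := by
  have := image_segment ℝ g.toAffineEquiv.toAffineMap x y
  simp only [AffineEquiv.coe_toAffineMap, AffineIsometryEquiv.coe_toAffineEquiv] at this
  rw [← this, g.injective.mem_set_image]

theorem angle_map_sub (g : ℂ ≃ᵃⁱ[ℝ] ℂ) (P Q R : ℂ) :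
    InnerProductGeometry.angle (g Q - g P) (g R - g P) =
      InnerProductGeometry.angle (Q - P) (R - P) := by
  have h1 := g.map_vsub Q P
  have h2 := g.map_vsub R P
  simp only [vsub_eq_sub] at h1 h2
  rw [← h1, ← h2]
  exact g.linearIsometryEquiv.toLinearIsometry.angle_map _ _

theorem IsoscelesTiling.map {ι : Type*} {a b : ℝ} {S : Set ℂ} {A B C : ι → ℂ}
    (h : IsoscelesTiling a b S A B C) (g : ℂ ≃ᵃⁱ[ℝ] ℂ) :
    IsoscelesTiling a b (g '' S) (fun i ↦ g (A i)) (fun i ↦ g (B i)) (fun i ↦ g (C i)) where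
  leg_pos := h.leg_pos
  base_pos := h.base_pos
  base_lt := h.base_lt
  dist_AB i := by rw [g.dist_map, h.dist_AB]
  dist_AC i := by rw [g.dist_map, h.dist_AC]
  dist_BC i := by rw [g.dist_map, h.dist_BC]
  iUnion_eq := by simp_rw [← image_convexHull_triple, ← Set.image_iUnion, h.iUnion_eq]
  disjoint i j hij := by
    simp_rw [← image_convexHull_triple]
    have : ∀ U : Set ℂ, interior (g '' U) = g '' interior U :=
      fun U ↦ (g.toHomeomorph.image_interior U).symm
    rw [this, this, Set.disjoint_image_iff g.injective]
    exact h.disjoint i j hij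

theorem angle_ofReal_eq_zero_or_pi {x y : ℝ} (hx : 0 < x) (hy : y ≠ 0) :
    InnerProductGeometry.angle (x : ℂ) (y : ℂ) = 0 ∨
      InnerProductGeometry.angle (x : ℂ) (y : ℂ) = Real.pi := by
  have h1 : (x : ℂ) = x • (1 : ℂ) := by simp
  have h2 : (y : ℂ) = y • (1 : ℂ) := by simp
  rw [h1, h2, InnerProductGeometry.angle_smul_left_of_pos _ _ hx]
  rcases lt_or_gt_of_ne hy with hy | hy
  · rw [InnerProductGeometry.angle_smul_right_of_neg _ _ hy,
      InnerProductGeometry.angle_self_neg_of_nonzero one_ne_zero]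
    simp
  · rw [InnerProductGeometry.angle_smul_right_of_pos _ _ hy,
      InnerProductGeometry.angle_self one_ne_zero]
    simp

/-- Normal position of an angle: vertex at the origin, one side along the positive real axis, the
other one in the upper half-plane. -/
theorem exists_normal_position {P Q R : ℂ} (hPQ : P ≠ Q) (hPR : P ≠ R)
    (h0 : 0 < InnerProductGeometry.angle (Q - P) (R - P))
    (hπ : InnerProductGeometry.angle (Q - P) (R - P) < Real.pi) :
    ∃ g : ℂ ≃ᵃⁱ[ℝ] ℂ, g P = 0 ∧ g Q = (dist P Q : ℝ) ∧ 0 < (g R).im := by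
  have hL : 0 < dist P Q := dist_pos.mpr hPQ
  have hL' : (dist P Q : ℂ) ≠ 0 := by exact_mod_cast hL.ne'
  have hu : ‖starRingEnd ℂ (Q - P) / (dist P Q : ℂ)‖ = 1 := by
    rw [norm_div, RCLike.norm_conj, ← dist_eq_norm, dist_comm Q P, Complex.norm_real,
      Real.norm_of_nonneg hL.le, div_self hL.ne']
  let c : Circle := ⟨starRingEnd ℂ (Q - P) / (dist P Q : ℂ), by simpa [Submonoid.unitSphere] using hu⟩
  let g : ℂ ≃ᵃⁱ[ℝ] ℂ :=
    (AffineIsometryEquiv.vaddConst ℝ P).symm.trans (rotation c).toAffineIsometryEquiv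
  have hg : ∀ z, g z = starRingEnd ℂ (Q - P) / (dist P Q : ℂ) * (z - P) := fun z ↦
    (rotation_apply c (z - P) :)
  have gP : g P = 0 := by simp [hg]
  have gQ : g Q = (dist P Q : ℝ) := by
    rw [hg, div_mul_eq_mul_div, mul_comm, Complex.mul_conj, Complex.normSq_eq_norm_sq,
      ← dist_eq_norm, dist_comm Q P]
    push_cast
    field_simp
  -- If R landed on the real axis, the angle at P would be 0 or π. When it lands below, complex
  -- conjugation moves it up.
  have him : (g R).im ≠ 0 := by
    intro him
    have hR : g R = ((g R).re : ℂ) := Complex.ext (by simp) (by simpa using him)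
    have hR0 : (g R).re ≠ 0 := by
      intro h
      rw [h, Complex.ofReal_zero, ← gP] at hR
      exact hPR (g.injective hR).symm
    rw [← angle_map_sub g, gP, gQ, sub_zero, sub_zero, hR] at h0 hπ
    rcases angle_ofReal_eq_zero_or_pi hL hR0 with h | h <;> linarith
  rcases lt_or_gt_of_ne him with him | him
  · refine ⟨g.trans Complex.conjLIE.toAffineIsometryEquiv, ?_, ?_, ?_⟩ <;> simp [gP, gQ, him]
  · exact ⟨g, gP, gQ, him⟩

/-! ### Angle sum at a vertex in normal position -/

section NormalPosition

variable {ι : Type*} {a b L : ℝ} {W : ℂ} {S : Set ℂ} {A B C : ι → ℂ}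

theorem IsoscelesTiling.subset (h : IsoscelesTiling a b S A B C) (i : ι) :
    convexHull ℝ {A i, B i, C i} ⊆ S :=
  h.iUnion_eq ▸ Set.subset_iUnion (fun i ↦ convexHull ℝ {A i, B i, C i}) i

theorem left_mem_convexHull_triple (x y z : ℂ) : x ∈ convexHull ℝ {x, y, z} :=
  subset_convexHull _ _ (by simp)

theorem mid_mem_convexHull_triple (x y z : ℂ) : y ∈ convexHull ℝ {x, y, z} :=
  subset_convexHull _ _ (by simp)

theorem right_mem_convexHull_triple (x y z : ℂ) : z ∈ convexHull ℝ {x, y, z} :=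
  subset_convexHull _ _ (by simp)

/-- The angle at `p` of an isosceles triangle with apex `x` of which `p` is a vertex. -/
noncomputable def vertexAngle (a b : ℝ) (x p : ℂ) : ℝ :=
  open Classical in if x = p then apexAngle a b else baseAngle a b

theorem vertexAngle_pos (ha : 0 < a) (hb : 0 < b) (hab : b < 2 * a) (x p : ℂ) :
    0 < vertexAngle a b x p := by
  rw [vertexAngle]
  split_ifs
  · exact apexAngle_pos ha hb
  · exact baseAngle_pos ha hab

theorem IsoscelesTiling.exists_directions (h : IsoscelesTiling a b S A B C)
    (hS : ∀ z ∈ S, 0 ≤ z.im) {i : ι} (h0 : A i = 0 ∨ B i = 0 ∨ C i = 0) :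
    ∃ s t, directions (convexHull ℝ {A i, B i, C i}) = Set.Icc s t ∧
      t - s = vertexAngle a b (A i) 0 := by
  have hA := hS _ (h.subset i (left_mem_convexHull_triple _ _ _))
  have hB := hS _ (h.subset i (mid_mem_convexHull_triple _ _ _))
  have hC := hS _ (h.subset i (right_mem_convexHull_triple _ _ _))
  have hAB : A i ≠ B i := dist_pos.mp (by rw [h.dist_AB]; exact h.leg_pos)
  have hAC : A i ≠ C i := dist_pos.mp (by rw [h.dist_AC]; exact h.leg_pos)
  have hBC : B i ≠ C i := dist_pos.mp (by rw [h.dist_BC]; exact h.base_pos)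
  have p1 := baseAngle_pos h.leg_pos h.base_lt
  have p2 := baseAngle_lt h.leg_pos h.base_pos
  have p3 := Real.pi_pos
  rcases h0 with h0 | h0 | h0
  · have key := angle_eq_apexAngle h.leg_pos h.base_pos h.base_lt (h.dist_AB i) (h.dist_AC i)
      (h.dist_BC i)
    rw [vertexAngle, if_pos h0]
    rw [h0] at hAB hAC key ⊢
    rw [sub_zero, sub_zero] at key
    rw [← key]
    exact exists_directions_triangle hAB.symm hAC.symm hB hC
      (by rw [key]; exact apexAngle_pos h.leg_pos h.base_pos)
      (by rw [key]; exact apexAngle_lt h.leg_pos h.base_lt)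
  · have key := angle_eq_baseAngle h.leg_pos h.base_pos (h.dist_AB i) (h.dist_AC i) (h.dist_BC i)
    rw [h0] at hAB hBC key ⊢
    rw [vertexAngle, if_neg hAB]
    rw [sub_zero, sub_zero] at key
    rw [← key, convexHull_triple_left_comm]
    exact exists_directions_triangle hAB hBC.symm hA hC (by rw [key]; exact p1)
      (by rw [key]; linarith)
  · have key := angle_eq_baseAngle h.leg_pos h.base_pos (h.dist_AC i) (h.dist_AB i)
      ((dist_comm _ _).trans (h.dist_BC i))
    rw [h0] at hAC hBC key ⊢
    rw [vertexAngle, if_neg hAC]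
    rw [sub_zero, sub_zero] at key
    rw [← key, convexHull_triple_right_comm, convexHull_triple_left_comm]
    exact exists_directions_triangle hAC hBC hA hB (by rw [key]; exact p1)
      (by rw [key]; linarith)

theorem IsoscelesTiling.directions_inter_subsingleton (h : IsoscelesTiling a b S A B C)
    (hS : ∀ z ∈ S, 0 ≤ z.im) {i j : ι} (hij : i ≠ j) (hi : A i = 0 ∨ B i = 0 ∨ C i = 0)
    (hj : A j = 0 ∨ B j = 0 ∨ C j = 0) :
    (directions (convexHull ℝ {A i, B i, C i}) ∩
      directions (convexHull ℝ {A j, B j, C j})).Subsingleton := by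
  have vertex_mem : ∀ k, A k = 0 ∨ B k = 0 ∨ C k = 0 →
      (0 : ℂ) ∈ convexHull ℝ {A k, B k, C k} := by
    intro k hk
    apply subset_convexHull
    rcases hk with hk | hk | hk <;> simp [hk]
  obtain ⟨s, t, hst, hθ⟩ := h.exists_directions hS hi
  refine _root_.directions_inter_subsingleton (convex_convexHull _ _) (convex_convexHull _ _)
    (h.disjoint i j hij) ⟨vertex_mem i hi, vertex_mem j hj⟩ hst ?_
  rw [hθ, vertexAngle]
  have := baseAngle_lt h.leg_pos h.base_pos
  have := Real.pi_pos
  split_ifs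
  · exact apexAngle_lt h.leg_pos h.base_lt
  · linarith

/-- Tiles in the upper half-plane with a common vertex at the origin: their angles there. -/
theorem IsoscelesTiling.volume_directions (h : IsoscelesTiling a b S A B C)
    (hS : ∀ z ∈ S, 0 ≤ z.im) (s : Finset ι) (hs : ∀ i ∈ s, A i = 0 ∨ B i = 0 ∨ C i = 0) :
    MeasureTheory.volume (⋃ i ∈ s, directions (convexHull ℝ {A i, B i, C i})) =
      ENNReal.ofReal (∑ i ∈ s, vertexAngle a b (A i) 0) :=
  volume_biUnion_Icc s (fun _ _ ↦ (vertexAngle_pos h.leg_pos h.base_pos h.base_lt _ _).le)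
    (fun i hi ↦ h.exists_directions hS (hs i hi))
    (fun i hi j hj hij ↦ h.directions_inter_subsingleton hS hij (hs i hi) (hs j hj))

/-- The two tiles occupy essentially disjoint sets of directions inside [0, π]. -/
theorem IsoscelesTiling.two_mul_apexAngle_le_of_apex_eq_zero (h : IsoscelesTiling a b S A B C)
    (hS : ∀ z ∈ S, 0 ≤ z.im) {i j : ι} (hij : i ≠ j) (hi : A i = 0) (hj : A j = 0) :
    2 * apexAngle a b ≤ Real.pi := by
  classical
  have key := h.volume_directions hS {i, j} (by
    intro k hk
    rcases Finset.mem_insert.mp hk with rfl | hk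
    · exact Or.inl hi
    · rw [Finset.mem_singleton.mp hk]
      exact Or.inl hj)
  rw [Finset.sum_pair hij, vertexAngle, vertexAngle, if_pos hi, if_pos hj] at key
  have hle : MeasureTheory.volume (⋃ k ∈ ({i, j} : Finset ι),
      directions (convexHull ℝ {A k, B k, C k})) ≤ MeasureTheory.volume (Set.Icc 0 Real.pi) := by
    apply MeasureTheory.measure_mono
    simp only [Set.iUnion_subset_iff]
    exact fun k _ τ hτ ↦ hτ.1
  rw [key, Real.volume_Icc, ENNReal.ofReal_le_ofReal_iff (by linarith [Real.pi_pos])] at hle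
  linarith

theorem im_nonneg_of_mem_triangle (hW : 0 < W.im) {z : ℂ}
    (hz : z ∈ convexHull ℝ {0, (L : ℂ), W}) : 0 ≤ z.im := by
  obtain ⟨p, q, r, hp, hq, hr, -, rfl⟩ := mem_convexHull_triple.mp hz
  simp
  positivity

theorem mem_segment_iff_im_eq_zero (hW : 0 < W.im) {z : ℂ}
    (hz : z ∈ convexHull ℝ {0, (L : ℂ), W}) : z ∈ segment ℝ (0 : ℂ) L ↔ z.im = 0 := by
  constructor
  · rintro ⟨p, q, hp, hq, -, rfl⟩
    simp
  · intro h
    obtain ⟨p, q, r, hp, hq, hr, hs, rfl⟩ := mem_convexHull_triple.mp hz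
    have hr0 : r = 0 := by simpa [hW.ne'] using h
    subst hr0
    exact ⟨p, q, hp, hq, by linarith, by simp⟩

/-- The origin is an extreme point: a linear functional vanishes there and is positive on the rest
of the big triangle, so a vertex carrying positive weight must be the origin. -/
theorem eq_zero_of_zero_mem_triangle (hL : 0 < L) (hW : 0 < W.im) {x y z : ℂ}
    (hx : x ∈ convexHull ℝ {0, (L : ℂ), W}) (hy : y ∈ convexHull ℝ {0, (L : ℂ), W})
    (hz : z ∈ convexHull ℝ {0, (L : ℂ), W}) (h0 : (0 : ℂ) ∈ convexHull ℝ {x, y, z}) :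
    x = 0 ∨ y = 0 ∨ z = 0 := by
  -- The functional is chosen to take the positive values L · Im W at L and Im W at W.
  have key : ∀ u ∈ convexHull ℝ {0, (L : ℂ), W},
      0 ≤ u.re * W.im + u.im * (1 - W.re) ∧ (u.re * W.im + u.im * (1 - W.re) = 0 → u = 0) := by
    intro u hu
    obtain ⟨p, q, r, hp, hq, hr, -, rfl⟩ := mem_convexHull_triple.mp hu
    have e : (p • (0 : ℂ) + q • (L : ℂ) + r • W).re * W.im +
        (p • (0 : ℂ) + q • (L : ℂ) + r • W).im * (1 - W.re) = q * (L * W.im) + r * W.im := by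
      simp
      ring
    rw [e]
    have e1 : 0 ≤ q * (L * W.im) := by positivity
    have e2 : 0 ≤ r * W.im := by positivity
    refine ⟨by positivity, fun h ↦ ?_⟩
    have hq0 : q = 0 := by
      have : q * (L * W.im) = 0 := by linarith
      simpa [hL.ne', hW.ne'] using this
    have hr0 : r = 0 := by
      have : r * W.im = 0 := by linarith
      simpa [hW.ne'] using this
    simp [hq0, hr0]
  obtain ⟨p, q, r, hp, hq, hr, hs, h⟩ := mem_convexHull_triple.mp h0
  obtain ⟨hx1, hx2⟩ := key x hx
  obtain ⟨hy1, hy2⟩ := key y hy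
  obtain ⟨hz1, hz2⟩ := key z hz
  have hre := congrArg Complex.re h
  have him := congrArg Complex.im h
  simp at hre him
  set φ := fun u : ℂ ↦ u.re * W.im + u.im * (1 - W.re) with hφ
  have hsum : p * φ x + q * φ y + r * φ z = 0 := by
    simp only [hφ]
    linear_combination W.im * hre + (1 - W.re) * him
  have m1 := mul_nonneg hp hx1
  have m2 := mul_nonneg hq hy1
  have m3 := mul_nonneg hr hz1
  by_contra! hcon
  have e1 : p = 0 := (mul_eq_zero.mp (show p * φ x = 0 by linarith)).resolve_right
    fun e ↦ hcon.1 (hx2 e)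
  have e2 : q = 0 := (mul_eq_zero.mp (show q * φ y = 0 by linarith)).resolve_right
    fun e ↦ hcon.2.1 (hy2 e)
  have e3 : r = 0 := (mul_eq_zero.mp (show r * φ z = 0 by linarith)).resolve_right
    fun e ↦ hcon.2.2 (hz2 e)
  linarith

open Classical in
theorem IsoscelesTiling.sum_vertexAngle_zero [Fintype ι] (hL : 0 < L) (hW : 0 < W.im)
    (h : IsoscelesTiling a b (convexHull ℝ {0, (L : ℂ), W}) A B C)
    (h0 : 0 < InnerProductGeometry.angle (L : ℂ) W)
    (hπ : InnerProductGeometry.angle (L : ℂ) W < Real.pi) :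
    ∑ i with 0 ∈ convexHull ℝ {A i, B i, C i}, vertexAngle a b (A i) 0 =
      InnerProductGeometry.angle (L : ℂ) W := by
  have hS : ∀ z ∈ convexHull ℝ {0, (L : ℂ), W}, 0 ≤ z.im := fun z ↦ im_nonneg_of_mem_triangle hW
  have key := h.volume_directions hS ({i | 0 ∈ convexHull ℝ {A i, B i, C i}} : Finset ι) (by
    intro i hi
    exact eq_zero_of_zero_mem_triangle hL hW (h.subset i (left_mem_convexHull_triple _ _ _))
      (h.subset i (mid_mem_convexHull_triple _ _ _))
      (h.subset i (right_mem_convexHull_triple _ _ _)) (Finset.mem_filter.mp hi).2)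
  have hcover : ⋃ i ∈ ({i | 0 ∈ convexHull ℝ {A i, B i, C i}} : Finset ι),
      directions (convexHull ℝ {A i, B i, C i}) =
        directions (convexHull ℝ {0, (L : ℂ), W}) := by
    apply Set.Subset.antisymm
    · simp only [Set.iUnion_subset_iff]
      rintro i - τ ⟨hτ, ε, hε, hmem⟩
      exact ⟨hτ, ε, hε, h.subset i hmem⟩
    · rintro τ ⟨hτ, ε, hε, hmem⟩
      -- The initial part of the ray stays in the big triangle. One closed tile contains points of
      -- it arbitrarily close to 0, hence also 0 itself.
      have hev : ∀ᶠ t : ℝ in 𝓝[>] 0, (t : ℂ) * Complex.exp (τ * Complex.I) ∈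
          ⋃ i, convexHull ℝ {A i, B i, C i} := by
        filter_upwards [Ioo_mem_nhdsGT hε] with t ht
        rw [h.iUnion_eq]
        have := (convex_convexHull ℝ {0, (L : ℂ), W}).smul_mem_of_zero_mem
          (left_mem_convexHull_triple _ _ _) hmem (t := t / ε)
          ⟨by have := ht.1; positivity, (div_le_one hε).mpr ht.2.le⟩
        convert this using 1
        rw [Complex.real_smul, ← mul_assoc, ← Complex.ofReal_mul, div_mul_cancel₀ _ hε.ne']
      obtain ⟨i, hi0, hi⟩ := exists_frequently_mem_of_cover
        (fun i ↦ isClosed_convexHull_triple (A i) (B i) (C i)) (by fun_prop)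
        nhdsWithin_le_nhds hev
      obtain ⟨t, ht, ht0⟩ := (hi.and_eventually self_mem_nhdsWithin).exists
      simp only [Set.mem_iUnion]
      exact ⟨i, by simpa using hi0, hτ, t, ht0, ht⟩
  have hW0 : W ≠ 0 := by
    rintro rfl
    simp at hW
  obtain ⟨s, t, hst, hθ⟩ := exists_directions_triangle (z := L) (w := W)
    (by exact_mod_cast hL.ne') hW0 (by simp) hW.le h0 hπ
  rw [hcover, hst, Real.volume_Icc, hθ, ENNReal.ofReal_eq_ofReal_iff h0.le
    (Finset.sum_nonneg fun i _ ↦ (vertexAngle_pos h.leg_pos h.base_pos h.base_lt _ _).le)] at key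
  exact key.symm

end NormalPosition

/-! ### Tile edges along an edge of the big triangle -/

/-- The tile `i` has a leg on the segment from `P` to `Q`. -/
def HasLegOn {ι : Type*} (A B C : ι → ℂ) (P Q : ℂ) (i : ι) : Prop :=
  A i ∈ segment ℝ P Q ∧ (B i ∈ segment ℝ P Q ∨ C i ∈ segment ℝ P Q)

/-- The tile `i` has its base on the segment from `P` to `Q`. -/
def HasBaseOn {ι : Type*} (B C : ι → ℂ) (P Q : ℂ) (i : ι) : Prop :=
  B i ∈ segment ℝ P Q ∧ C i ∈ segment ℝ P Q

/-- The part of a plane set on the real axis. -/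
def realSlice (S : Set ℂ) : Set ℝ := {x | (x : ℂ) ∈ S}

theorem realSlice_triangle_of_base {x y w : ℂ} (hx : x.im = 0) (hy : y.im = 0) (hw : 0 < w.im) :
    realSlice (convexHull ℝ {x, y, w}) = Set.uIcc x.re y.re := by
  ext t
  rw [← segment_eq_uIcc]
  constructor
  · intro ht
    obtain ⟨p, q, r, hp, hq, hr, hs, h⟩ := mem_convexHull_triple.mp ht
    have him := congrArg Complex.im h
    have hre := congrArg Complex.re h
    simp [hx, hy, hw.ne'] at him hre
    subst him
    exact ⟨p, q, hp, hq, by linarith, by simpa using hre⟩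
  · rintro ⟨p, q, hp, hq, hs, rfl⟩
    refine mem_convexHull_triple.mpr ⟨p, q, 0, hp, hq, le_rfl, by linarith, ?_⟩
    apply Complex.ext <;> simp [hx, hy]

theorem realSlice_triangle_subsingleton {x y w : ℂ} (hx : 0 ≤ x.im) (hy : 0 < y.im)
    (hw : 0 < w.im) : (realSlice (convexHull ℝ {x, y, w})).Subsingleton := by
  suffices H : ∀ t ∈ realSlice (convexHull ℝ {x, y, w}), t = x.re by
    intro t ht t' ht'
    rw [H t ht, H t' ht']
  intro t ht
  obtain ⟨p, q, r, hp, hq, hr, hs, h⟩ := mem_convexHull_triple.mp ht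
  have him := congrArg Complex.im h
  have hre := congrArg Complex.re h
  simp at him hre
  have m1 := mul_nonneg hp hx
  have m2 := mul_nonneg hq hy.le
  have m3 := mul_nonneg hr hw.le
  have e2 : q = 0 := (mul_eq_zero.mp (show q * y.im = 0 by linarith)).resolve_right hy.ne'
  have e3 : r = 0 := (mul_eq_zero.mp (show r * w.im = 0 by linarith)).resolve_right hw.ne'
  have e1 : p = 1 := by linarith
  rw [e1, e2, e3] at hre
  linarith

theorem realSlice_triangle (L : ℝ) (hL : 0 < L) {W : ℂ} (hW : 0 < W.im) :
    realSlice (convexHull ℝ {0, (L : ℂ), W}) = Set.Icc 0 L := by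
  rw [realSlice_triangle_of_base (by simp) (by simp) hW]
  simp [Set.uIcc_of_le hL.le]

theorem dist_eq_abs_re_sub {x y : ℂ} (hx : x.im = 0) (hy : y.im = 0) :
    dist x y = |x.re - y.re| := by
  rw [Complex.dist_of_im_eq (hx.trans hy.symm), Real.dist_eq]

section NormalPosition

variable {ι : Type*} {a b L : ℝ} {W : ℂ} {S : Set ℂ} {A B C : ι → ℂ}

/-- A tile with all vertices on the axis would have b = 0 or b = 2a. -/
theorem IsoscelesTiling.exists_im_pos (h : IsoscelesTiling a b S A B C)
    (hS : ∀ z ∈ S, 0 ≤ z.im) (i : ι) : 0 < (A i).im ∨ 0 < (B i).im ∨ 0 < (C i).im := by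
  by_contra! hcon
  have hA := hcon.1.antisymm (hS _ (h.subset i (left_mem_convexHull_triple _ _ _)))
  have hB := hcon.2.1.antisymm (hS _ (h.subset i (mid_mem_convexHull_triple _ _ _)))
  have hC := hcon.2.2.antisymm (hS _ (h.subset i (right_mem_convexHull_triple _ _ _)))
  have h1 := h.dist_AB i
  have h2 := h.dist_AC i
  have h3 := h.dist_BC i
  have p1 := h.leg_pos
  have p2 := h.base_pos
  have p3 := h.base_lt
  rw [dist_eq_abs_re_sub hA hB] at h1
  rw [dist_eq_abs_re_sub hA hC] at h2
  rw [dist_eq_abs_re_sub hB hC] at h3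
  rcases abs_cases ((A i).re - (B i).re) with h | h <;>
  rcases abs_cases ((A i).re - (C i).re) with h' | h' <;>
  rcases abs_cases ((B i).re - (C i).re) with h'' | h'' <;> linarith

/-- If two tiles share points x < y of the axis, both also contain a point just above the midpoint,
giving three non-collinear common points. -/
theorem IsoscelesTiling.realSlice_inter_subsingleton (h : IsoscelesTiling a b S A B C)
    (hS : ∀ z ∈ S, 0 ≤ z.im) {i j : ι} (hij : i ≠ j) :
    (realSlice (convexHull ℝ {A i, B i, C i}) ∩
      realSlice (convexHull ℝ {A j, B j, C j})).Subsingleton := by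
  suffices H : ∀ x y, x < y → x ∈ realSlice (convexHull ℝ {A i, B i, C i}) ∩
      realSlice (convexHull ℝ {A j, B j, C j}) → y ∈ realSlice (convexHull ℝ {A i, B i, C i}) ∩
      realSlice (convexHull ℝ {A j, B j, C j}) → False by
    intro x hx y hy
    rcases lt_trichotomy x y with h | h | h
    · exact (H _ _ h hx hy).elim
    · exact h
    · exact (H _ _ h hy hx).elim
  intro x y hxy hx hy
  have up : ∀ k, x ∈ realSlice (convexHull ℝ {A k, B k, C k}) →
      y ∈ realSlice (convexHull ℝ {A k, B k, C k}) → ∀ᶠ η : ℝ in 𝓝[>] 0,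
        (((x + y) / 2 : ℝ) : ℂ) + η * Complex.I ∈ convexHull ℝ {A k, B k, C k} := by
    intro k hxk hyk
    have hm : (x + y) / 2 ∈ Set.Ioo x y := ⟨by linarith, by linarith⟩
    rcases h.exists_im_pos hS k with h' | h' | h'
    · exact eventually_add_mul_I_mem (convex_convexHull _ _) hxk hyk
        (left_mem_convexHull_triple _ _ _) h' hm
    · exact eventually_add_mul_I_mem (convex_convexHull _ _) hxk hyk
        (mid_mem_convexHull_triple _ _ _) h' hm
    · exact eventually_add_mul_I_mem (convex_convexHull _ _) hxk hyk
        (right_mem_convexHull_triple _ _ _) h' hm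
  obtain ⟨η, ⟨h1, h2⟩, hη⟩ :=
    (((up i hx.1 hy.1).and (up j hx.2 hy.2)).and self_mem_nhdsWithin).exists
  have key := cross_eq_zero_of_disjoint_interior (convex_convexHull _ _) (convex_convexHull _ _)
    (h.disjoint i j hij) hx hy ⟨h1, h2⟩
  have hη' : 0 < η := hη
  simp at key
  rcases key with key | key <;> linarith

theorem IsoscelesTiling.iUnion_realSlice (h : IsoscelesTiling a b S A B C) :
    ⋃ i, realSlice (convexHull ℝ {A i, B i, C i}) = realSlice S := by
  rw [← h.iUnion_eq]
  ext x
  simp [realSlice]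

/-- The shape of a tile along the real axis. -/
theorem IsoscelesTiling.realSlice_cases (h : IsoscelesTiling a b S A B C)
    (hS : ∀ z ∈ S, 0 ≤ z.im) (i : ι) :
    ((A i).im = 0 ∧ ∃ D, (D = B i ∨ D = C i) ∧ D.im = 0 ∧ |(A i).re - D.re| = a ∧
      realSlice (convexHull ℝ {A i, B i, C i}) = Set.uIcc (A i).re D.re) ∨
    ((B i).im = 0 ∧ (C i).im = 0 ∧ 0 < (A i).im ∧ |(B i).re - (C i).re| = b ∧
      realSlice (convexHull ℝ {A i, B i, C i}) = Set.uIcc (B i).re (C i).re) ∨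
    (¬ ((A i).im = 0 ∧ ((B i).im = 0 ∨ (C i).im = 0)) ∧ ¬ ((B i).im = 0 ∧ (C i).im = 0) ∧
      (realSlice (convexHull ℝ {A i, B i, C i})).Subsingleton) := by
  have hA := (hS _ (h.subset i (left_mem_convexHull_triple _ _ _))).eq_or_lt'
  have hB := (hS _ (h.subset i (mid_mem_convexHull_triple _ _ _))).eq_or_lt'
  have hC := (hS _ (h.subset i (right_mem_convexHull_triple _ _ _))).eq_or_lt'
  have hne := h.exists_im_pos hS i
  rcases hA with hA | hA <;> rcases hB with hB | hB <;> rcases hC with hC | hC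
  · rcases hne with h' | h' | h' <;> linarith
  · refine Or.inl ⟨hA, B i, Or.inl rfl, hB, ?_, realSlice_triangle_of_base hA hB hC⟩
    rw [← dist_eq_abs_re_sub hA hB, h.dist_AB]
  · refine Or.inl ⟨hA, C i, Or.inr rfl, hC, ?_, ?_⟩
    · rw [← dist_eq_abs_re_sub hA hC, h.dist_AC]
    · rw [convexHull_triple_right_comm]
      exact realSlice_triangle_of_base hA hC hB
  · refine Or.inr (Or.inr ⟨fun h ↦ ?_, fun h ↦ ?_, realSlice_triangle_subsingleton hA.ge hB hC⟩)
    · rcases h.2 with h | h <;> linarith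
    · linarith [h.1]
  · refine Or.inr (Or.inl ⟨hB, hC, hA, ?_, ?_⟩)
    · rw [← dist_eq_abs_re_sub hB hC, h.dist_BC]
    · rw [convexHull_triple_left_comm, convexHull_triple_right_comm]
      exact realSlice_triangle_of_base hB hC hA
  · refine Or.inr (Or.inr ⟨fun h ↦ by linarith [h.1], fun h ↦ by linarith [h.2], ?_⟩)
    rw [convexHull_triple_left_comm]
    exact realSlice_triangle_subsingleton hB.ge hA hC
  · refine Or.inr (Or.inr ⟨fun h ↦ by linarith [h.1], fun h ↦ by linarith [h.1], ?_⟩)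
    rw [convexHull_triple_right_comm, convexHull_triple_left_comm]
    exact realSlice_triangle_subsingleton hC.ge hA hB
  · refine Or.inr (Or.inr ⟨fun h ↦ by linarith [h.1], fun h ↦ by linarith [h.1], ?_⟩)
    exact realSlice_triangle_subsingleton hA.le hB hC

theorem IsoscelesTiling.hasLegOn_iff (hW : 0 < W.im)
    (h : IsoscelesTiling a b (convexHull ℝ {0, (L : ℂ), W}) A B C) (i : ι) :
    HasLegOn A B C 0 L i ↔ (A i).im = 0 ∧ ((B i).im = 0 ∨ (C i).im = 0) := by
  rw [HasLegOn, mem_segment_iff_im_eq_zero hW (h.subset i (left_mem_convexHull_triple _ _ _)),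
    mem_segment_iff_im_eq_zero hW (h.subset i (mid_mem_convexHull_triple _ _ _)),
    mem_segment_iff_im_eq_zero hW (h.subset i (right_mem_convexHull_triple _ _ _))]

theorem IsoscelesTiling.hasBaseOn_iff (hW : 0 < W.im)
    (h : IsoscelesTiling a b (convexHull ℝ {0, (L : ℂ), W}) A B C) (i : ι) :
    HasBaseOn B C 0 L i ↔ (B i).im = 0 ∧ (C i).im = 0 := by
  rw [HasBaseOn, mem_segment_iff_im_eq_zero hW (h.subset i (mid_mem_convexHull_triple _ _ _)),
    mem_segment_iff_im_eq_zero hW (h.subset i (right_mem_convexHull_triple _ _ _))]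

/-- The slices cover [0, L] with null overlaps and have length a, b or 0. The coefficients count the
tiles of each kind, so a vanishing coefficient excludes that kind. -/
theorem IsoscelesTiling.length_eq_zero_ofReal [Fintype ι] (hL : 0 < L) (hW : 0 < W.im)
    (h : IsoscelesTiling a b (convexHull ℝ {0, (L : ℂ), W}) A B C) :
    ∃ x y : ℕ, L = x * a + y * b ∧ (x = 0 → ∀ i, ¬ HasLegOn A B C 0 L i) ∧
      (y = 0 → ∀ i, ¬ HasBaseOn B C 0 L i) := by
  classical
  have hS : ∀ z ∈ convexHull ℝ {0, (L : ℂ), W}, 0 ≤ z.im := fun z ↦ im_nonneg_of_mem_triangle hW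
  have hvol : ∀ i, MeasurableSet (realSlice (convexHull ℝ {A i, B i, C i})) ∧
      MeasureTheory.volume (realSlice (convexHull ℝ {A i, B i, C i})) =
        ENNReal.ofReal ((if HasLegOn A B C 0 L i then a else 0) +
          (if HasBaseOn B C 0 L i then b else 0)) := by
    intro i
    have hmeas : MeasurableSet (realSlice (convexHull ℝ {A i, B i, C i})) :=
      ((isClosed_convexHull_triple _ _ _).preimage Complex.continuous_ofReal).measurableSet
    refine ⟨hmeas, ?_⟩
    have hne := h.exists_im_pos hS i
    rw [h.hasLegOn_iff hW, h.hasBaseOn_iff hW]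
    rcases h.realSlice_cases hS i with ⟨hA, D, hD, hD0, ha, hI⟩ | ⟨hB, hC, hA, hb, hI⟩ |
      ⟨hleg, hbase, hI⟩
    · rw [if_pos ⟨hA, by rcases hD with rfl | rfl <;> simp [hD0]⟩, if_neg (by
        rintro ⟨h1, h2⟩
        rcases hne with h' | h' | h' <;> linarith), hI, Real.volume_interval, abs_sub_comm, ha,
        add_zero]
    · rw [if_neg (by rintro ⟨h1, h2⟩; linarith), if_pos ⟨hB, hC⟩, hI, Real.volume_interval,
        abs_sub_comm, hb, zero_add]
    · rw [if_neg hleg, if_neg hbase, hI.measure_zero]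
      simp
  have hsum := volume_biUnion_eq_sum Finset.univ
    (J := fun i ↦ realSlice (convexHull ℝ {A i, B i, C i})) (fun i _ ↦ (hvol i).1)
    (fun i _ j _ hij ↦ h.realSlice_inter_subsingleton hS hij)
  simp only [Finset.mem_univ, Set.iUnion_true] at hsum
  have hnn : ∀ i ∈ Finset.univ, 0 ≤ (if HasLegOn A B C 0 L i then a else 0) +
      (if HasBaseOn B C 0 L i then b else 0) := by
    intro i _
    have := h.leg_pos
    have := h.base_pos
    split_ifs <;> positivity
  rw [h.iUnion_realSlice, realSlice_triangle L hL hW, Real.volume_Icc, sub_zero,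
    Finset.sum_congr rfl fun i _ ↦ (hvol i).2, ← ENNReal.ofReal_sum_of_nonneg hnn,
    ENNReal.ofReal_eq_ofReal_iff hL.le (Finset.sum_nonneg hnn), Finset.sum_add_distrib,
    ← Finset.sum_filter, ← Finset.sum_filter, Finset.sum_const, Finset.sum_const, nsmul_eq_mul,
    nsmul_eq_mul] at hsum
  refine ⟨_, _, hsum, fun h0 i hi ↦ ?_, fun h0 i hi ↦ ?_⟩
  · exact Finset.filter_eq_empty_iff.mp (Finset.card_eq_zero.mp h0) (Finset.mem_univ i) hi
  · exact Finset.filter_eq_empty_iff.mp (Finset.card_eq_zero.mp h0) (Finset.mem_univ i) hi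

/-- Near a point of an edge, on either side, some tile reaching that point lies along the edge. -/
theorem IsoscelesTiling.exists_mem_realSlice [Finite ι] (h : IsoscelesTiling a b S A B C)
    {p : ℝ} {l : Filter ℝ} [l.NeBot] (hl : l ≤ 𝓝 p) (hS : ∀ᶠ t in l, t ∈ realSlice S)
    {U : Set ℝ} (hU : U ∈ l) : ∃ i, p ∈ realSlice (convexHull ℝ {A i, B i, C i}) ∧
      ∃ q ∈ U, q ∈ realSlice (convexHull ℝ {A i, B i, C i}) := by
  obtain ⟨i, hi, hf⟩ := exists_frequently_mem_of_cover
    (F := fun i ↦ realSlice (convexHull ℝ {A i, B i, C i}))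
    (fun i ↦ (isClosed_convexHull_triple _ _ _).preimage Complex.continuous_ofReal)
    continuous_id hl (by rw [h.iUnion_realSlice]; exact hS)
  obtain ⟨q, hq, hqU⟩ := (hf.and_eventually hU).exists
  exact ⟨i, hi, q, hqU, hq⟩

/-- A tile that contains 0 and a positive real has a slice with two points, which only a leg or a
base on the axis can produce. -/
theorem IsoscelesTiling.exists_hasLegOn_or_hasBaseOn_zero [Finite ι] (hL : 0 < L) (hW : 0 < W.im)
    (h : IsoscelesTiling a b (convexHull ℝ {0, (L : ℂ), W}) A B C) :
    ∃ i, 0 ∈ convexHull ℝ {A i, B i, C i} ∧ (HasLegOn A B C 0 L i ∨ HasBaseOn B C 0 L i) := by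
  have hS : ∀ z ∈ convexHull ℝ {0, (L : ℂ), W}, 0 ≤ z.im := fun z ↦ im_nonneg_of_mem_triangle hW
  obtain ⟨i, hi, q, hq0, hq⟩ := h.exists_mem_realSlice (p := 0) (l := 𝓝[>] 0) nhdsWithin_le_nhds
    (by rw [realSlice_triangle L hL hW]; exact Icc_mem_nhdsGT hL) self_mem_nhdsWithin
  refine ⟨i, by simpa [realSlice] using hi, ?_⟩
  rw [h.hasLegOn_iff hW, h.hasBaseOn_iff hW]
  by_contra! hcon
  rcases h.realSlice_cases hS i with ⟨hA, D, hD, hD0, -⟩ | ⟨hB, hC, -⟩ | ⟨-, -, hI⟩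
  · have := hcon.1 hA
    rcases hD with rfl | rfl
    · exact this.1 hD0
    · exact this.2 hD0
  · exact hcon.2 hB hC
  · exact (hI hi hq).not_lt hq0

/-! ### Orientation of the legs along an edge when the apex angle is obtuse -/

section NormalPosition

variable {ι : Type*} {a b L : ℝ} {W : ℂ} {S : Set ℂ} {A B C : ι → ℂ}

theorem IsoscelesTiling.two_mul_apexAngle_le (h : IsoscelesTiling a b S A B C)
    (hS : ∀ z ∈ S, 0 ≤ z.im) {i j : ι} (hij : i ≠ j) (hi : (A i).im = 0) (hA : A j = A i) :
    2 * apexAngle a b ≤ Real.pi := by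
  refine (h.map (AffineIsometryEquiv.constVAdd ℝ ℂ (-A i))).two_mul_apexAngle_le_of_apex_eq_zero
    ?_ hij (by simp) (by simp [hA])
  rintro _ ⟨z, hz, rfl⟩
  simpa [hi] using hS z hz

theorem IsoscelesTiling.exists_apex_eq_ofReal [Finite ι] (hL : 0 < L) (hW : 0 < W.im)
    (h : IsoscelesTiling a b (convexHull ℝ {0, (L : ℂ), W}) A B C)
    (hbase : ∀ i, ¬ HasBaseOn B C 0 L i) (hapex : ∀ i, A i ≠ 0)
    (hangle : Real.pi / 2 < apexAngle a b) : ∃ i, A i = L := by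
  have hS : ∀ z ∈ convexHull ℝ {0, (L : ℂ), W}, 0 ≤ z.im := fun z ↦ im_nonneg_of_mem_triangle hW
  have ha := h.leg_pos
  have hslice : ∀ i t, t ∈ realSlice (convexHull ℝ {A i, B i, C i}) → t ∈ Set.Icc 0 L := by
    intro i t ht
    rw [← realSlice_triangle L hL hW]
    exact h.subset i ht
  have hapex_slice : ∀ i, (A i).im = 0 → (A i).re ∈ realSlice (convexHull ℝ {A i, B i, C i}) := by
    intro i hi
    have : (((A i).re : ℝ) : ℂ) = A i := Complex.ext (by simp) (by simp [hi])
    rw [realSlice, Set.mem_ofPred_eq, this]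
    exact left_mem_convexHull_triple _ _ _
  have hcases : ∀ i x y, x ∈ realSlice (convexHull ℝ {A i, B i, C i}) →
      y ∈ realSlice (convexHull ℝ {A i, B i, C i}) → x < y → (A i).im = 0 ∧
      (realSlice (convexHull ℝ {A i, B i, C i}) = Set.Icc (A i).re ((A i).re + a) ∨
        realSlice (convexHull ℝ {A i, B i, C i}) = Set.Icc ((A i).re - a) (A i).re) := by
    intro i x y hx hy hxy
    rcases h.realSlice_cases hS i with ⟨hA, D, hD, hD0, hl, hI⟩ | ⟨hB, hC, -⟩ | ⟨-, -, hI⟩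
    · refine ⟨hA, ?_⟩
      rw [hI]
      rcases abs_cases ((A i).re - D.re) with h' | h'
      · right
        rw [Set.uIcc_of_ge (by linarith)]
        congr 1
        linarith
      · left
        rw [Set.uIcc_of_le (by linarith)]
        congr 1
        linarith
    · exact (hbase i ((h.hasBaseOn_iff hW i).mpr ⟨hB, hC⟩)).elim
    · exact absurd (hI hx hy) hxy.ne
  -- No tile along the edge has its apex at its left end.
  have hgood : ∀ i, (A i).im = 0 →
      realSlice (convexHull ℝ {A i, B i, C i}) ≠ Set.Icc (A i).re ((A i).re + a) := by
    by_contra! hcon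
    -- Take the leftmost offender. By minimality the tile `j` reaching it from the left has its apex
    -- at its right end, so the two obtuse apices coincide.
    obtain ⟨i, ⟨hi, hI⟩, hmin⟩ := Set.exists_min_image
      {i | (A i).im = 0 ∧
        realSlice (convexHull ℝ {A i, B i, C i}) = Set.Icc (A i).re ((A i).re + a)}
      (fun i ↦ (A i).re) (Set.toFinite _) hcon
    have hp := hslice i _ (hapex_slice i hi)
    have hp0 : 0 < (A i).re := hp.1.lt_of_ne fun h0 ↦
      hapex i (Complex.ext (by simp [← h0]) (by simp [hi]))
    obtain ⟨j, hj, q, hqp, hq⟩ := h.exists_mem_realSlice (p := (A i).re) (l := 𝓝[<] (A i).re)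
      nhdsWithin_le_nhds (by
        rw [realSlice_triangle L hL hW]
        filter_upwards [Ioo_mem_nhdsLT hp0] with t ht
        exact ⟨ht.1.le, ht.2.le.trans hp.2⟩) self_mem_nhdsWithin
    have hqp' : q < (A i).re := hqp
    have hij : i ≠ j := by
      rintro rfl
      rw [hI] at hq
      linarith [hq.1]
    obtain ⟨hj0, hJ | hJ⟩ := hcases j _ _ hq hj hqp'
    · have := hmin j ⟨hj0, hJ⟩
      rw [hJ] at hq
      linarith [hq.1]
    · have hle : (A i).re ≤ (A j).re := by
        rw [hJ] at hj
        exact hj.2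
      have hsub := h.realSlice_inter_subsingleton hS hij
      rw [hI, hJ] at hsub
      have h1 : (A j).re - a ≤ (A i).re := by
        rw [hJ] at hj
        exact hj.1
      -- Both slices contain the interval from the apex of `i` to this minimum, so it must
      -- degenerate.
      have heq := hsub (x := (A i).re) ⟨⟨le_rfl, by linarith⟩, ⟨h1, hle⟩⟩
        (y := min (A j).re ((A i).re + a))
        ⟨⟨le_min hle (by linarith), min_le_right _ _⟩,
          ⟨le_min (by linarith) (by linarith), min_le_left _ _⟩⟩
      have hre : (A j).re = (A i).re := by
        rcases min_cases (A j).re ((A i).re + a) with h' | h' <;> linarith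
      have := h.two_mul_apexAngle_le hS hij hi (Complex.ext hre (by rw [hi, hj0]))
      linarith
  obtain ⟨i, hi, q, hqL, hq⟩ := h.exists_mem_realSlice (p := L) (l := 𝓝[<] L)
    nhdsWithin_le_nhds (by rw [realSlice_triangle L hL hW]; exact Icc_mem_nhdsLT hL)
    self_mem_nhdsWithin
  obtain ⟨hi0, hI | hI⟩ := hcases i _ _ hq hi hqL
  · exact (hgood i hi0 hI).elim
  · refine ⟨i, Complex.ext ?_ (by simpa using hi0)⟩
    have h1 := (hslice i _ (hapex_slice i hi0)).2
    rw [hI] at hi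
    simpa using le_antisymm h1 hi.2

end NormalPosition

/-! ### Transfer from normal position to an arbitrary triangle -/

section GeneralPosition

variable {ι : Type*} {a b : ℝ} {P Q R : ℂ} {A B C : ι → ℂ}

theorem hasLegOn_map_iff (g : ℂ ≃ᵃⁱ[ℝ] ℂ) {i : ι} :
    HasLegOn (fun i ↦ g (A i)) (fun i ↦ g (B i)) (fun i ↦ g (C i)) (g P) (g Q) i ↔
      HasLegOn A B C P Q i := by
  simp only [HasLegOn, mem_segment_map_iff]

theorem hasBaseOn_map_iff (g : ℂ ≃ᵃⁱ[ℝ] ℂ) {i : ι} :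
    HasBaseOn (fun i ↦ g (B i)) (fun i ↦ g (C i)) (g P) (g Q) i ↔ HasBaseOn B C P Q i := by
  simp only [HasBaseOn, mem_segment_map_iff]

theorem IsoscelesTiling.exists_map_normal_position
    (h : IsoscelesTiling a b (convexHull ℝ {P, Q, R}) A B C) (hPQ : P ≠ Q) (hPR : P ≠ R)
    (h0 : 0 < InnerProductGeometry.angle (Q - P) (R - P))
    (hπ : InnerProductGeometry.angle (Q - P) (R - P) < Real.pi) :
    ∃ g : ℂ ≃ᵃⁱ[ℝ] ℂ, g P = 0 ∧ g Q = (dist P Q : ℝ) ∧ 0 < (g R).im ∧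
      IsoscelesTiling a b (convexHull ℝ {0, ((dist P Q : ℝ) : ℂ), g R}) (fun i ↦ g (A i))
        (fun i ↦ g (B i)) (fun i ↦ g (C i)) := by
  obtain ⟨g, hP, hQ, hR⟩ := exists_normal_position hPQ hPR h0 hπ
  refine ⟨g, hP, hQ, hR, ?_⟩
  have := h.map g
  rwa [image_convexHull_triple, hP, hQ] at this

open Classical in
/-- The angles of the tiles at a vertex of the tiled triangle add up to the angle there. -/
theorem IsoscelesTiling.sum_vertexAngle [Fintype ι]
    (h : IsoscelesTiling a b (convexHull ℝ {P, Q, R}) A B C) (hPQ : P ≠ Q) (hPR : P ≠ R)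
    (h0 : 0 < InnerProductGeometry.angle (Q - P) (R - P))
    (hπ : InnerProductGeometry.angle (Q - P) (R - P) < Real.pi) :
    ∑ i with P ∈ convexHull ℝ {A i, B i, C i}, vertexAngle a b (A i) P =
      InnerProductGeometry.angle (Q - P) (R - P) := by
  obtain ⟨g, hP, hQ, hR, h'⟩ := h.exists_map_normal_position hPQ hPR h0 hπ
  have hang := angle_map_sub g P Q R
  rw [hP, hQ, sub_zero, sub_zero] at hang
  have key := h'.sum_vertexAngle_zero (dist_pos.mpr hPQ) hR (by rwa [hang]) (by rwa [hang])
  simp only [← hP, mem_convexHull_map_iff, vertexAngle, g.injective.eq_iff] at key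
  rw [hang] at key
  simpa only [vertexAngle] using key

/-- An edge of the tiled triangle is the union of the legs and bases of tiles lying on it. -/
theorem IsoscelesTiling.dist_eq [Fintype ι]
    (h : IsoscelesTiling a b (convexHull ℝ {P, Q, R}) A B C) (hPQ : P ≠ Q) (hPR : P ≠ R)
    (h0 : 0 < InnerProductGeometry.angle (Q - P) (R - P))
    (hπ : InnerProductGeometry.angle (Q - P) (R - P) < Real.pi) :
    ∃ x y : ℕ, dist P Q = x * a + y * b ∧ (x = 0 → ∀ i, ¬ HasLegOn A B C P Q i) ∧
      (y = 0 → ∀ i, ¬ HasBaseOn B C P Q i) := by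
  obtain ⟨g, hP, hQ, hR, h'⟩ := h.exists_map_normal_position hPQ hPR h0 hπ
  have key := h'.length_eq_zero_ofReal (dist_pos.mpr hPQ) hR
  rw [← hP, ← hQ] at key
  simpa only [hasLegOn_map_iff, hasBaseOn_map_iff] using key

theorem IsoscelesTiling.exists_hasLegOn_or_hasBaseOn [Finite ι]
    (h : IsoscelesTiling a b (convexHull ℝ {P, Q, R}) A B C) (hPQ : P ≠ Q) (hPR : P ≠ R)
    (h0 : 0 < InnerProductGeometry.angle (Q - P) (R - P))
    (hπ : InnerProductGeometry.angle (Q - P) (R - P) < Real.pi) :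
    ∃ i, P ∈ convexHull ℝ {A i, B i, C i} ∧ (HasLegOn A B C P Q i ∨ HasBaseOn B C P Q i) := by
  obtain ⟨g, hP, hQ, hR, h'⟩ := h.exists_map_normal_position hPQ hPR h0 hπ
  have key := h'.exists_hasLegOn_or_hasBaseOn_zero (dist_pos.mpr hPQ) hR
  rw [← hP, ← hQ] at key
  simpa only [hasLegOn_map_iff, hasBaseOn_map_iff, mem_convexHull_map_iff] using key

/-- If the apex angle is obtuse, then along an edge on which no tile has its base, all apices point
in the same direction, so that one of them is at an end of the edge. -/
theorem IsoscelesTiling.exists_apex_eq [Finite ι]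
    (h : IsoscelesTiling a b (convexHull ℝ {P, Q, R}) A B C) (hPQ : P ≠ Q) (hPR : P ≠ R)
    (h0 : 0 < InnerProductGeometry.angle (Q - P) (R - P))
    (hπ : InnerProductGeometry.angle (Q - P) (R - P) < Real.pi)
    (hbase : ∀ i, ¬ HasBaseOn B C P Q i) (hapex : ∀ i, A i ≠ P)
    (hangle : Real.pi / 2 < apexAngle a b) : ∃ i, A i = Q := by
  obtain ⟨g, hP, hQ, hR, h'⟩ := h.exists_map_normal_position hPQ hPR h0 hπ
  obtain ⟨i, hi⟩ := h'.exists_apex_eq_ofReal (dist_pos.mpr hPQ) hR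
    (by rw [← hP, ← hQ]; simpa only [hasBaseOn_map_iff] using hbase)
    (fun i ↦ by rw [← hP]; exact fun e ↦ hapex i (g.injective e)) hangle
  exact ⟨i, g.injective (hi.trans hQ.symm)⟩

end GeneralPosition

/-! ### Irrationality of b/a and its arithmetic consequences -/

/-- Here cos α = b/(2a), and the only angle of Niven's theorem strictly between 0 and π/2 is π/3. -/
theorem irrational_div_of_baseAngle {a b : ℝ} (ha : 0 < a) (hb : 0 < b) (hab : b < 2 * a) {q : ℚ}
    (hq : baseAngle a b = q * Real.pi) (h3 : q ≠ 1 / 3) : Irrational (b / a) := by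
  rintro ⟨c, hc⟩
  have hcos := cos_baseAngle ha hb hab
  have h0 := baseAngle_pos ha hab
  have h1 := baseAngle_lt ha hb
  have hπ := Real.pi_pos
  have := niven_angle_eq ⟨q, hq⟩ ⟨c / 2, by
    rw [hcos]; push_cast; rw [hc, div_div, mul_comm]⟩ ⟨h0.le, by linarith⟩
  rcases this with h | h | h | h | h
  · linarith
  · apply h3
    have : (q : ℝ) = ((1 / 3 : ℚ) : ℝ) := by
      have e : (q : ℝ) * Real.pi = 1 / 3 * Real.pi := by rw [← hq, h]; ring
      push_cast
      exact mul_right_cancel₀ hπ.ne' e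
    exact_mod_cast this
  · linarith
  · linarith
  · rw [Set.mem_singleton_iff] at h
    linarith

/-- A scaling factor with rational square, mapping `a` and `b` to nonnegative integral combinations
of `a` and `b`, either keeps the two lengths apart or exchanges them. -/
theorem eq_zero_of_scaled_combination {a b s : ℝ} (ha : 0 < a) (hirr : Irrational (b / a)) {n : ℕ}
    (hs : s ^ 2 = n) {x y z w : ℕ} (h1 : s * a = x * a + y * b) (h2 : s * b = z * a + w * b) :
    (y = 0 ∧ z = 0) ∨ (x = 0 ∧ w = 0) := by
  set β := b / a with hβ
  have hb : b = β * a := by rw [hβ]; field_simp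
  rw [hb] at h1 h2
  have h1 : s = x + y * β := mul_right_cancel₀ ha.ne' (by linarith)
  have h2 : s * β = z + w * β := mul_right_cancel₀ ha.ne' (by linarith)
  by_cases hrat : Irrational s
  · right
    -- Here s is an eigenvalue of the matrix with rows (x, y) and (z, w). Its characteristic
    -- equation with s² = n makes (x + w)s rational, so the trace x + w vanishes.
    have h3 : s * ((w + x : ℕ) : ℝ) = ((n + w * x - z * y : ℚ) : ℝ) := by
      push_cast
      rw [← hs]
      linear_combination (w - s) * h1 - y * h2
    have h4 : w + x = 0 := by
      by_contra hne
      have hne' : ((w + x : ℕ) : ℝ) ≠ 0 := by exact_mod_cast hne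
      exact hrat ⟨(n + w * x - z * y : ℚ) / ((w + x : ℕ) : ℚ), by
        push_cast at h3 hne' ⊢
        rw [← h3]
        field_simp⟩
    omega
  · left
    obtain ⟨c, rfl⟩ := exists_rat_of_not_irrational hrat
    constructor
    · by_contra hy
      have hy' : (y : ℝ) ≠ 0 := by exact_mod_cast hy
      exact hirr ⟨(c - x) / y, by push_cast; rw [h1]; field_simp; ring⟩
    · by_contra hz
      have hz' : (z : ℝ) ≠ 0 := by exact_mod_cast hz
      -- Since (s − w)b/a = z, the case s = w would give z = 0.
      have hcw : (c : ℝ) - w ≠ 0 := by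
        intro h0
        apply hz'
        linear_combination β * h0 - h2
      exact hirr ⟨z / (c - w), by push_cast; field_simp; linear_combination -h2⟩

/-- One term `v` already exhausts the sum, and a second positive term would exceed it. -/
theorem forall_of_sum_ite_eq {ι : Type*} {F : Finset ι} {p : ι → Prop} [DecidablePred p]
    {u v : ℝ} (hu : 0 < u) (hv : 0 < v) (hF : 2 ≤ F.card)
    (hsum : ∑ i ∈ F, (if p i then u else v) = v) : (∀ i ∈ F, p i) ∧ F.card * u = v := by
  have hall : ∀ i ∈ F, p i := by
    by_contra! hcon
    obtain ⟨i, hi, hpi⟩ := hcon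
    obtain ⟨j, hj, hji⟩ := Finset.exists_mem_ne (by omega : 1 < F.card) i
    have hnn : ∀ k ∈ F, 0 ≤ if p k then u else v := by
      intro k _
      split_ifs <;> positivity
    have := Finset.add_le_sum hnn hi hj hji.symm
    rw [hsum, if_neg hpi] at this
    split_ifs at this <;> linarith
  refine ⟨hall, ?_⟩
  rw [Finset.sum_congr rfl fun i hi ↦ if_pos (hall i hi), Finset.sum_const, nsmul_eq_mul] at hsum
  exact hsum

/-! ### The two cases: a split base vertex and a split apex -/

section

variable {ι : Type*} {a b s : ℝ} {P Q R : ℂ} {A B C : ι → ℂ} {n : ℕ}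

theorem baseAngle_mul (hs : 0 < s) : baseAngle (s * a) (s * b) = baseAngle a b := by
  rw [baseAngle, baseAngle, mul_left_comm, mul_div_mul_left _ _ hs.ne']

theorem apexAngle_mul (hs : 0 < s) : apexAngle (s * a) (s * b) = apexAngle a b := by
  rw [apexAngle, apexAngle, baseAngle_mul hs]

theorem IsoscelesTiling.angle_base (h : IsoscelesTiling a b (convexHull ℝ {P, Q, R}) A B C)
    (hs : 0 < s) (hPQ : dist P Q = s * a) (hPR : dist P R = s * a) (hQR : dist Q R = s * b) :
    InnerProductGeometry.angle (P - Q) (R - Q) = baseAngle a b := by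
  have := h.leg_pos
  have := h.base_pos
  rw [angle_eq_baseAngle (by positivity) (by positivity) hPQ hPR hQR, baseAngle_mul hs]

open Classical in
theorem IsoscelesTiling.sum_vertexAngle_base [Fintype ι]
    (h : IsoscelesTiling a b (convexHull ℝ {P, Q, R}) A B C)
    (hs : 0 < s) (hPQ : dist P Q = s * a) (hPR : dist P R = s * a) (hQR : dist Q R = s * b) :
    ∑ i with Q ∈ convexHull ℝ {A i, B i, C i}, vertexAngle a b (A i) Q = baseAngle a b := by
  have ha := h.leg_pos
  have hb := h.base_pos
  have hα := baseAngle_pos ha h.base_lt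
  have hα' := baseAngle_lt ha hb
  have hang := h.angle_base hs hPQ hPR hQR
  have hne : Q ≠ P := dist_pos.mp (by rw [dist_comm, hPQ]; positivity)
  have hne' : Q ≠ R := dist_pos.mp (by rw [hQR]; positivity)
  rw [convexHull_triple_left_comm] at h
  rw [h.sum_vertexAngle hne hne' (by linarith) (by linarith [Real.pi_pos]), hang]

/-- A single apex angle at Q would already exceed the angle sum there. -/
theorem IsoscelesTiling.apex_ne_base [Finite ι] (h : IsoscelesTiling a b (convexHull ℝ {P, Q, R}) A B C)
    (hs : 0 < s) (hPQ : dist P Q = s * a) (hPR : dist P R = s * a) (hQR : dist Q R = s * b)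
    (hlt : baseAngle a b < apexAngle a b) (i : ι) : A i ≠ Q := by
  classical
  have := Fintype.ofFinite ι
  intro hi
  have hsum := h.sum_vertexAngle_base hs hPQ hPR hQR
  have := Finset.single_le_sum (f := fun i ↦ vertexAngle a b (A i) Q)
    (fun i _ ↦ (vertexAngle_pos h.leg_pos h.base_pos h.base_lt (A i) Q).le)
    (Finset.mem_filter.mpr ⟨Finset.mem_univ i, hi ▸ left_mem_convexHull_triple _ _ _⟩ :
      i ∈ ({i | Q ∈ convexHull ℝ {A i, B i, C i}} : Finset ι))
  rw [hsum] at this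
  simp only [vertexAngle, if_pos hi] at this
  linarith

/-- The lengths of a leg and of the base of the tiled triangle in terms of the tiles on them. -/
theorem IsoscelesTiling.edges_dichotomy [Fintype ι]
    (h : IsoscelesTiling a b (convexHull ℝ {P, Q, R}) A B C)
    (hs : 0 < s) (hPQ : dist P Q = s * a) (hPR : dist P R = s * a) (hQR : dist Q R = s * b)
    (hn : s ^ 2 = n) (hirr : Irrational (b / a)) :
    ((∀ i, ¬ HasBaseOn B C Q P i) ∧ ∀ i, ¬ HasLegOn A B C Q R i) ∨
      ((∀ i, ¬ HasLegOn A B C Q P i) ∧ ∀ i, ¬ HasBaseOn B C Q R i) := by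
  have ha := h.leg_pos
  have hb := h.base_pos
  have hα := baseAngle_pos ha h.base_lt
  have hα' := baseAngle_lt ha hb
  have hπ := Real.pi_pos
  have hang := h.angle_base hs hPQ hPR hQR
  have hne : Q ≠ P := dist_pos.mp (by rw [dist_comm, hPQ]; positivity)
  have hne' : Q ≠ R := dist_pos.mp (by rw [hQR]; positivity)
  rw [convexHull_triple_left_comm] at h
  obtain ⟨x, y, h1, hx, hy⟩ := h.dist_eq hne hne' (by linarith) (by linarith)
  rw [convexHull_triple_right_comm] at h
  rw [InnerProductGeometry.angle_comm] at hang
  obtain ⟨z, w, h2, hz, hw⟩ := h.dist_eq hne' hne (by linarith) (by linarith)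
  rw [dist_comm, hPQ] at h1
  rw [hQR] at h2
  rcases eq_zero_of_scaled_combination ha hirr hn h1 h2 with ⟨h3, h4⟩ | ⟨h3, h4⟩
  · exact Or.inl ⟨hy h3, hz h4⟩
  · exact Or.inr ⟨hx h3, hw h4⟩

open Classical in
-- All tiles at Q have their apex there, so each of the two edges from Q carries a tile leg, whereas
-- `IsoscelesTiling.edges_dichotomy` forbids legs on one of them.
theorem IsoscelesTiling.not_split_base [Fintype ι]
    (h : IsoscelesTiling a b (convexHull ℝ {P, Q, R}) A B C)
    (hs : 0 < s) (hPQ : dist P Q = s * a) (hPR : dist P R = s * a) (hQR : dist Q R = s * b)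
    (hn : s ^ 2 = n) :
    ¬ 2 ≤ ({i | Q ∈ convexHull ℝ {A i, B i, C i}} : Finset ι).card := by
  intro hcard
  have ha := h.leg_pos
  have hb := h.base_pos
  have hα := baseAngle_pos ha h.base_lt
  have hα' := baseAngle_lt ha hb
  have hπ := Real.pi_pos
  have hsum := h.sum_vertexAngle_base hs hPQ hPR hQR
  simp only [vertexAngle] at hsum
  obtain ⟨hall, hk⟩ := forall_of_sum_ite_eq (apexAngle_pos ha hb) hα hcard hsum
  have hapex : ∀ i, Q ∈ convexHull ℝ {A i, B i, C i} → A i = Q := fun i hi ↦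
    hall i (Finset.mem_filter.mpr ⟨Finset.mem_univ i, hi⟩)
  generalize ({i | Q ∈ convexHull ℝ {A i, B i, C i}} : Finset ι).card = k at hcard hk
  have hirr : Irrational (b / a) := by
    -- Solve α = k(π − 2α) for α; the value π/3 would need k = 1.
    refine irrational_div_of_baseAngle ha hb h.base_lt (q := k / (2 * k + 1)) ?_ ?_
    · rw [apexAngle] at hk
      push_cast
      field_simp
      linarith
    · intro h3
      field_simp at h3
      have : (2 : ℚ) ≤ k := by exact_mod_cast hcard
      linarith
  have hang := h.angle_base hs hPQ hPR hQR
  have hne : Q ≠ P := dist_pos.mp (by rw [dist_comm, hPQ]; positivity)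
  have hne' : Q ≠ R := dist_pos.mp (by rw [hQR]; positivity)
  -- With the apex at Q, a base on the edge would also place a leg on it.
  have hleg : ∀ i D, A i = Q → HasLegOn A B C Q D i ∨ HasBaseOn B C Q D i →
      HasLegOn A B C Q D i := by
    rintro i D hi (h' | h')
    · exact h'
    · exact ⟨hi ▸ left_mem_segment _ _ _, Or.inl h'.1⟩
  have hdich := h.edges_dichotomy hs hPQ hPR hQR hn hirr
  rw [convexHull_triple_left_comm] at h
  rcases hdich with ⟨-, h'⟩ | ⟨h', -⟩
  · rw [convexHull_triple_right_comm] at h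
    rw [InnerProductGeometry.angle_comm] at hang
    obtain ⟨i, hi, hi'⟩ := h.exists_hasLegOn_or_hasBaseOn hne' hne (by linarith) (by linarith)
    exact h' i (hleg i R (hapex i hi) hi')
  · obtain ⟨i, hi, hi'⟩ := h.exists_hasLegOn_or_hasBaseOn hne hne' (by linarith) (by linarith)
    exact h' i (hleg i P (hapex i hi) hi')

open Classical in
-- No apex of a tile lies at any corner of the big triangle, yet on the edge from Q without tile
-- bases the obtuse apex angle forces an apex at the far end.
theorem IsoscelesTiling.not_split_apex [Fintype ι]
    (h : IsoscelesTiling a b (convexHull ℝ {P, Q, R}) A B C)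
    (hs : 0 < s) (hPQ : dist P Q = s * a) (hPR : dist P R = s * a) (hQR : dist Q R = s * b)
    (hn : s ^ 2 = n) (hobl : apexAngle a b ≠ Real.pi / 2) :
    ¬ 2 ≤ ({i | P ∈ convexHull ℝ {A i, B i, C i}} : Finset ι).card := by
  intro hcard
  have ha := h.leg_pos
  have hb := h.base_pos
  have hα := baseAngle_pos ha h.base_lt
  have hα' := baseAngle_lt ha hb
  have hπ := Real.pi_pos
  have hne : P ≠ Q := dist_pos.mp (by rw [hPQ]; positivity)
  have hne' : P ≠ R := dist_pos.mp (by rw [hPR]; positivity)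
  have hangP : InnerProductGeometry.angle (Q - P) (R - P) = apexAngle a b := by
    rw [angle_eq_apexAngle (by positivity) (by positivity) (by nlinarith [h.base_lt]) hPQ hPR hQR,
      apexAngle_mul hs]
  have hsum := h.sum_vertexAngle hne hne' (by rw [hangP]; exact apexAngle_pos ha hb)
    (by rw [hangP]; exact apexAngle_lt ha h.base_lt)
  simp only [vertexAngle, hangP] at hsum
  -- Swapping the branches lets the base angle play the role of `u`.
  simp_rw [← ite_not (p := A _ = P)] at hsum
  obtain ⟨hall, hk⟩ := forall_of_sum_ite_eq hα (apexAngle_pos ha hb) hcard hsum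
  have hapex : ∀ i, A i ≠ P := fun i hi ↦
    hall i (Finset.mem_filter.mpr ⟨Finset.mem_univ i, hi ▸ left_mem_convexHull_triple _ _ _⟩) hi
  generalize ({i | P ∈ convexHull ℝ {A i, B i, C i}} : Finset ι).card = k at hcard hk
  -- For k = 2, γ = 2α and γ = π − 2α give γ = π/2; this is where obliqueness enters.
  have hk3 : 3 ≤ k := by
    rcases hcard.eq_or_lt with rfl | h2
    · exfalso
      apply hobl
      push_cast at hk
      rw [apexAngle] at hk ⊢
      linarith
    · exact h2
  have hk3' : (3 : ℝ) ≤ k := by exact_mod_cast hk3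
  -- From 3α ≤ γ = π − 2α follows α ≤ π/5, so γ ≥ 3π/5.
  have hangle : Real.pi / 2 < apexAngle a b := by
    have : 3 * baseAngle a b ≤ apexAngle a b := by rw [← hk]; gcongr
    rw [apexAngle] at this ⊢
    linarith
  have hlt : baseAngle a b < apexAngle a b := by linarith
  have hirr : Irrational (b / a) := by
    -- Solve kα = π − 2α for α; the value π/3 would need k = 1.
    refine irrational_div_of_baseAngle ha hb h.base_lt (q := 1 / (k + 2)) ?_ ?_
    · rw [apexAngle] at hk
      push_cast
      field_simp
      linarith
    · intro h3
      field_simp at h3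
      have : (3 : ℚ) ≤ k := by exact_mod_cast hk3
      linarith
  have hang := h.angle_base hs hPQ hPR hQR
  have hQ : ∀ i, A i ≠ Q := h.apex_ne_base hs hPQ hPR hQR hlt
  have hR : ∀ i, A i ≠ R := by
    have h' := h
    rw [convexHull_triple_right_comm] at h'
    exact h'.apex_ne_base hs hPR hPQ ((dist_comm _ _).trans hQR) hlt
  have hQR' : Q ≠ R := dist_pos.mp (by rw [hQR]; positivity)
  have hdich := h.edges_dichotomy hs hPQ hPR hQR hn hirr
  rw [convexHull_triple_left_comm] at h
  rcases hdich with ⟨h', -⟩ | ⟨-, h'⟩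
  · obtain ⟨i, hi⟩ := h.exists_apex_eq hne.symm hQR' (by linarith) (by linarith) h' hQ hangle
    exact hapex i hi
  · rw [convexHull_triple_right_comm] at h
    rw [InnerProductGeometry.angle_comm] at hang
    obtain ⟨i, hi⟩ := h.exists_apex_eq hQR' hne.symm (by linarith) (by linarith) h' hQ hangle
    exact hR i hi

end

/-! ### Similarities, areas and the common scale -/

/-- A similarity of the plane is a homothety followed by an isometry. -/
theorem exists_affineIsometryEquiv_smul (f : Plane ≃ᵈ Plane) :
    ∃ g : Plane ≃ᵃⁱ[ℝ] Plane, ∀ x, f x = g (((Dilation.ratio f : NNReal) : ℝ) • x) := by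
  set ρ : ℝ := ((Dilation.ratio f : NNReal) : ℝ) with hρ
  have hρ0 : 0 < ρ := NNReal.coe_pos.mpr (Dilation.ratio_pos f)
  -- Shrinking by the ratio first turns `f` into a surjective isometry, which is affine by
  -- Mazur–Ulam.
  let e : Plane ≃ᵢ Plane :=
    { toEquiv := (Homeomorph.smulOfNeZero ρ⁻¹ (inv_ne_zero hρ0.ne')).toEquiv.trans f.toEquiv
      isometry_toFun := Isometry.of_dist_eq fun x y ↦ by
        change dist (f (ρ⁻¹ • x)) (f (ρ⁻¹ • y)) = _
        rw [Dilation.dist_eq, ← hρ, dist_smul₀, norm_inv, Real.norm_of_nonneg hρ0.le,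
          mul_inv_cancel_left₀ hρ0.ne'] }
  refine ⟨e.toRealAffineIsometryEquiv, fun x ↦ ?_⟩
  change f x = f (ρ⁻¹ • ρ • x)
  rw [inv_smul_smul₀ hρ0.ne']

theorem dilation_image_convexHull (f : Plane ≃ᵈ Plane) (S : Set Plane) :
    f '' convexHull ℝ S = convexHull ℝ (f '' S) := by
  obtain ⟨g, hg⟩ := exists_affineIsometryEquiv_smul f
  have key := (g.toAffineEquiv.toAffineMap.comp
    (((Dilation.ratio f : NNReal) : ℝ) •
      (LinearMap.id : Plane →ₗ[ℝ] Plane)).toAffineMap).image_convexHull S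
  have hf : ⇑(g.toAffineEquiv.toAffineMap.comp
    (((Dilation.ratio f : NNReal) : ℝ) • (LinearMap.id : Plane →ₗ[ℝ] Plane)).toAffineMap) = f := by
    ext1 x
    exact (hg x).symm
  rwa [hf] at key

open MeasureTheory Pointwise in
theorem volume_dilation_image (f : Plane ≃ᵈ Plane) (S : Set Plane) :
    volume (f '' S) = ENNReal.ofReal (((Dilation.ratio f : NNReal) : ℝ) ^ 2) * volume S := by
  obtain ⟨g, hg⟩ := exists_affineIsometryEquiv_smul f
  have himage : f '' S = g '' (((Dilation.ratio f : NNReal) : ℝ) • S) := by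
    rw [← Set.image_smul, Set.image_image]
    exact Set.image_congr fun x _ ↦ hg x
  rw [himage, ← EuclideanSpace.euclideanHausdorffMeasure_eq_volume,
    g.isometry.euclideanHausdorffMeasure_image,
    EuclideanSpace.euclideanHausdorffMeasure_eq_volume, Measure.addHaar_smul,
    finrank_euclideanSpace_fin, abs_of_nonneg (by positivity)]

open MeasureTheory in
-- The overlap lies in the two frontiers, and frontiers of convex sets are null.
theorem aedisjoint_of_disjoint_interior {S S' : Set Plane} (hS : Convex ℝ S) (hS' : Convex ℝ S')
    (hd : Disjoint (interior S) (interior S')) : AEDisjoint volume S S' := by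
  refine measure_mono_null (t := frontier S ∪ frontier S') ?_
    (measure_union_null (hS.addHaar_frontier volume) (hS'.addHaar_frontier volume))
  rintro x ⟨hx, hx'⟩
  by_contra hcon
  rw [Set.mem_union, not_or] at hcon
  have h1 : x ∈ interior S := by
    by_contra hx1
    exact hcon.1 ⟨subset_closure hx, hx1⟩
  have h2 : x ∈ interior S' := by
    by_contra hx1
    exact hcon.2 ⟨subset_closure hx', hx1⟩
  exact hd.le_bot ⟨h1, h2⟩

open MeasureTheory in
/-- The area relation for a dissection into `r` similar copies, all at the scale `ρ`. -/
theorem card_mul_sq_ratio_eq_one {S : Set Plane} (h0 : volume S ≠ 0)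
    (hfin : volume S ≠ ⊤) {r : ℕ} {f : Fin r → Plane ≃ᵈ Plane} {ρ : ℝ}
    (hρ : ∀ i, ((Dilation.ratio (f i) : NNReal) : ℝ) = ρ) (hconv : ∀ i, Convex ℝ (f i '' S))
    (hunion : ⋃ i, f i '' S = S)
    (hd : ∀ i j, i ≠ j → Disjoint (interior (f i '' S)) (interior (f j '' S))) :
    r * ρ ^ 2 = 1 := by
  have key := measure_iUnion₀ (μ := (volume : Measure Plane)) (f := fun i ↦ f i '' S)
    (fun i j hij ↦ aedisjoint_of_disjoint_interior (hconv i) (hconv j) (hd i j hij))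
    (fun i ↦ (hconv i).nullMeasurableSet volume)
  simp only [hunion, volume_dilation_image, hρ, tsum_fintype, Finset.sum_const, Finset.card_univ,
    Fintype.card_fin, nsmul_eq_mul] at key
  rw [← mul_assoc] at key
  have h1 : (r : ENNReal) * ENNReal.ofReal (ρ ^ 2) = 1 :=
    (ENNReal.mul_left_inj h0 hfin).mp (by rw [one_mul, ← key])
  rw [← ENNReal.ofReal_natCast, ← ENNReal.ofReal_mul (by positivity)] at h1
  exact ENNReal.ofReal_eq_one.mp h1

/-! ### From reptilings in the Euclidean plane to isosceles tilings in ℂ -/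

theorem theorem10 (T : Affine.Triangle ℝ Plane) (hiso : IsIsosceles T) (hobl : IsOblique T)
    (k : ℕ) (hk : 2 ≤ k) :
    ¬ ∃ (r : ℕ) (tile : Fin r → Set Plane),
      IsReptiling (convexHull ℝ (Set.range T.points)) r tile ∧ IsSplitting T k tile := by
  classical
  rintro ⟨r, tile, ⟨⟨hr, hsim, hunion, hdisj⟩, hcongr⟩, -, v, hv⟩
  obtain ⟨i, j, l, hij, hjl, hil, hdist⟩ := hiso
  choose f hf using hsim
  set P := T.points i with hP
  set Q := T.points j with hQ
  set R := T.points l with hR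
  have hcases : ∀ m : Fin 3, m = i ∨ m = j ∨ m = l := by omega
  have hrange : Set.range T.points = {P, Q, R} := by
    ext x
    simp only [Set.mem_range, Set.mem_insert_iff, Set.mem_singleton_iff]
    constructor
    · rintro ⟨m, rfl⟩
      rcases hcases m with rfl | rfl | rfl <;> simp [P, Q, R]
    · rintro (rfl | rfl | rfl) <;> simp [P, Q, R]
  have hncol : ¬ Collinear ℝ {P, Q, R} := by
    rw [← hrange]
    exact affineIndependent_iff_not_collinear.mp T.independent
  have hPQ : 0 < dist P Q := dist_pos.mpr (T.independent.injective.ne hij)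
  have hQR : 0 < dist Q R := dist_pos.mpr (T.independent.injective.ne hjl)
  -- The triangle inequality is strict because the vertices are not collinear.
  have hlt : dist Q R < 2 * dist P Q := by
    have : dist Q R < dist Q P + dist P R := by
      rw [dist_lt_dist_add_dist_iff]
      intro h
      apply hncol
      rw [Set.insert_comm]
      exact h.collinear
    rw [dist_comm Q P] at this
    linarith
  set S := convexHull ℝ (Set.range T.points) with hS
  -- All tiles have the same scale.
  have hi0 : 0 < r := by omega
  set ρ : ℝ := ((Dilation.ratio (f ⟨0, hi0⟩) : NNReal) : ℝ) with hρ
  have hρ0 : 0 < ρ := NNReal.coe_pos.mpr (Dilation.ratio_pos _)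
  have hdiam : 0 < Metric.diam S := by
    have hb : Bornology.IsBounded S :=
      ((Set.finite_range T.points).isCompact_convexHull ℝ).isBounded
    refine hPQ.trans_le (Metric.dist_le_diam_of_mem hb ?_ ?_) <;>
    exact subset_convexHull _ _ (Set.mem_range_self _)
  have hratio : ∀ m, ((Dilation.ratio (f m) : NNReal) : ℝ) = ρ := by
    intro m
    obtain ⟨g, hg⟩ := hcongr m ⟨0, hi0⟩
    -- Congruent tiles have equal diameters, and each diameter is the ratio times the positive
    -- diameter of `S`.
    have h1 := g.diam_image (tile m)
    rw [hg, ← hf, ← hf, Dilation.diam_image, Dilation.diam_image] at h1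
    exact (mul_right_cancel₀ hdiam.ne' h1).symm
  have himage : ∀ m, tile m = convexHull ℝ {f m P, f m Q, f m R} := by
    intro m
    rw [← hf, hS, dilation_image_convexHull, hrange, Set.image_insert_eq, Set.image_pair]
  have hρr : r * ρ ^ 2 = 1 := by
    have hint : (interior S).Nonempty := by
      rw [hS, interior_convexHull_nonempty_iff_affineSpan_eq_top,
        T.independent.affineSpan_eq_top_iff_card_eq_finrank_add_one]
      simp
    refine card_mul_sq_ratio_eq_one (S := S) ?_ ?_ hratio (fun m ↦ ?_) ?_ ?_
    · exact (MeasureTheory.Measure.measure_pos_of_nonempty_interior _ hint).ne'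
    · exact ((Set.finite_range T.points).isCompact_convexHull ℝ).measure_lt_top.ne
    · rw [hf, himage]
      exact convex_convexHull _ _
    · simp_rw [hf]
      exact hunion
    · simp_rw [hf]
      exact hdisj
  -- Transfer to the complex plane.
  let e : Plane ≃ₗᵢ[ℝ] ℂ := Complex.orthonormalBasisOneI.repr.symm
  have hehull : ∀ x y z : Plane,
      e '' convexHull ℝ {x, y, z} = convexHull ℝ {e x, e y, e z} := by
    intro x y z
    have := e.toLinearEquiv.toLinearMap.image_convexHull {x, y, z}
    simpa [Set.image_insert_eq] using this
  have htile : ∀ m, convexHull ℝ {e (f m P), e (f m Q), e (f m R)} = e '' tile m := by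
    intro m
    rw [himage, hehull]
  have hT : convexHull ℝ {e P, e Q, e R} = e '' S := by
    rw [hS, hrange, hehull]
  have hd : ∀ m x y, dist (e (f m x)) (e (f m y)) = ρ * dist x y := by
    intro m x y
    rw [e.dist_map, Dilation.dist_eq, hratio]
  have htiling : IsoscelesTiling (ρ * dist P Q) (ρ * dist Q R) (convexHull ℝ {e P, e Q, e R})
      (fun m ↦ e (f m P)) (fun m ↦ e (f m Q)) (fun m ↦ e (f m R)) :=
    { leg_pos := by positivity
      base_pos := by positivity
      base_lt := by nlinarith
      dist_AB := fun m ↦ hd m P Q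
      dist_AC := fun m ↦ by rw [hd, hdist]
      dist_BC := fun m ↦ hd m Q R
      iUnion_eq := by simp_rw [htile, hT, ← Set.image_iUnion, hunion]
      disjoint := fun m m' hm ↦ by
        have : ∀ U : Set Plane, interior (e '' U) = e '' interior U :=
          fun U ↦ (e.toHomeomorph.image_interior U).symm
        rw [htile, htile, this, this, Set.disjoint_image_iff e.injective]
        exact hdisj m m' hm }
  have hs : 0 < ρ⁻¹ := by positivity
  have hn : ρ⁻¹ ^ 2 = (r : ℝ) := by
    field_simp
    linarith
  have e1 : dist (e P) (e Q) = ρ⁻¹ * (ρ * dist P Q) := by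
    rw [e.dist_map, inv_mul_cancel_left₀ hρ0.ne']
  have e2 : dist (e P) (e R) = ρ⁻¹ * (ρ * dist P Q) := by
    rw [e.dist_map, inv_mul_cancel_left₀ hρ0.ne', hdist]
  have e3 : dist (e Q) (e R) = ρ⁻¹ * (ρ * dist Q R) := by
    rw [e.dist_map, inv_mul_cancel_left₀ hρ0.ne']
  have hangle : apexAngle (ρ * dist P Q) (ρ * dist Q R) ≠ Real.pi / 2 := by
    rw [apexAngle_mul hρ0, ← angle_eq_apexAngle hPQ hQR hlt rfl hdist.symm rfl]
    exact hobl j i l hij.symm hil hjl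
  have hcard : 2 ≤ ({m | e (T.points v) ∈
      convexHull ℝ {e (f m P), e (f m Q), e (f m R)}} : Finset (Fin r)).card := by
    have : ({m | e (T.points v) ∈ convexHull ℝ {e (f m P), e (f m Q), e (f m R)}} :
        Finset (Fin r)).card = k := by
      rw [← hv, ← Set.ncard_coe_finset]
      congr 1
      ext m
      simp [htile]
    omega
  rcases hcases v with rfl | rfl | rfl
  · exact htiling.not_split_apex hs e1 e2 e3 hn hangle hcard
  · exact htiling.not_split_base hs e1 e2 e3 hn hcard
  -- The second base corner reduces to the first by exchanging Q and R.
  · have htiling' := htiling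
    rw [convexHull_triple_right_comm] at htiling'
    exact htiling'.not_split_base hs e2 e1 ((dist_comm _ _).trans e3) hn hcard
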